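/- Let $\mathfrak{sl}_2$ have basis $e,h,f$ with $[h,e]=2e$, $[h,f]=-2f$, $[e,f]=h$ and rescaled Killing form $\kappa(x,y)=\operatorname{tr}(xy)$. Let $\mathfrak h=\mathbb Ch$, let $\alpha=2\omega\in\mathfrak h^*$ be the simple root, $\omega=\rho$ the fundamental weight (and Weyl vector), $\mathsf Q=\mathbb Z\alpha$ the root lattice, and let $\langle\cdot,\cdot\rangle$ be the bilinear form on $\mathfrak h^*$ with $\langle\alpha,\alpha\rangle=2$. Let $\widehat{\mathfrak{sl}}_2=\mathfrak{sl}_2\otimes\mathbb C[t,t^{-1}]\oplus\mathbb CK\oplus\mathbb CL_0$ with $x_n=x\otimes t^n$, $[x_m,y_n]=[x,y]_{m+n}+m\,\delta_{m+n,0}\,\kappa(x,y)K$, $[L_0,x_n]=-n\,x_n$ and $K$ central. Fix a level $k\in\mathbb C$ and a conformal weight $\Delta\in\mathbb C$. An $\mathfrak{sl}_2$-module $M$ induces the relaxed Verma module $U(\widehat{\mathfrak{sl}}_2)\otimes_{U(\widehat{\mathfrak{sl}}_2^{\ge})}M$, where $\widehat{\mathfrak{sl}}_2^{\ge}$ is spanned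 by $K$, $L_0$ and the $x_n$ with $n\ge0$, and on $M$ the $x_n$ with $n>0$ act as $0$, the zero modes act through $\mathfrak{sl}_2$, $K$ acts as $k$ and $L_0$ as $\Delta$; its space of ground states is $M$. For $q\in\mathbb C$ and $\lambda\in\mathfrak h^*/\mathsf Q$, let $\mathcal D_{\lambda;q}$ be the dense $\mathfrak{sl}_2$-module with basis $v_\mu$, $\mu\in\lambda$, and action $$e\,v_\mu=\tfrac12\bigl(q-\langle\mu,\mu+2\rho\rangle\bigr)v_{\mu+\alpha},\qquad h\,v_\mu=\mu(h)\,v_\mu,\qquad f\,v_\mu=v_{\mu-\alpha}.$$ Let $\mathcal R_{\lambda;q}$ be the relaxed Verma module induced from $\mathcal D_{\lambda;q}$, and let $\mathcal E_{\lambda;q}$ be the quotient of $\mathcal R_{\lambda;q}$ by the sum of all of its submodules that have zero intersection with the space of ground states. For $\nu\in\mathfrak h^*$, let $\mathcal L^-_\nu$ be the simple quotient of the relaxed Verma module induced from the lowest-weight Verma $\mathfrak{sl}_2$-module of lowest weight $\nu$. Let $\Lambda_q\subset\mathfrak h^*/\mathsf Q$ be the set of cosets containing some $\mu$ with $\langle\mu,\mu+2\rho\rangle=q$.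 A level-$k$ weight module is a module $\mathcal M$ on which $K$ acts as $k$ and which is the direct sum of finite-dimensional weight spaces $\mathcal M(\mu,n)$, $\mu\in\mathfrak h^*$, $n\in\mathbb C$, consisting of the $h_0$-eigenvectors of weight $\mu$ that are generalised $L_0$-eigenvectors of eigenvalue $n$. Its string functions are the generalised formal power series $\mathrm s_\mu[\mathcal M](\mathsf q)=\sum_{n\in\mathbb C}\dim\mathcal M(\mu,n)\,\mathsf q^n$, and $\mathcal M$ is stringy if its non-zero string functions all coincide. Limits of generalised formal power series are taken coefficientwise. **Theorem.** Let $k,\Delta,q\in\mathbb C$ and $\lambda\in\Lambda_q$. Then $\mathcal E_{\lambda;q}$ is a stringy level-$k$ weight module. Its string function $\mathrm s_\nu[\mathcal E_{\lambda;q}]$ is non-zero if and only if $\nu\in\lambda$. Let $\mu\in\mathfrak h^*$ be any solution of $\langle\mu,\mu+2\rho\rangle=q$ if $\sqrt{1+2q}\notin\mathbb Z$, and the maximal solution (with respect to the real part of $\mu(h)$) if $\sqrt{1+2q}\in\mathbb Z$. Then $\mathcal L^-_{\mu+\alpha}$ is a level-$k$ weight module and, for all $\nu\in\lambda$, $$\mathrm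 s_\nu[\mathcal E_{\lambda;q}](\mathsf q)=\mathrm s_{\infty}[\mathcal L^-_{\mu+\alpha}](\mathsf q):=\lim_{m\to\infty}\mathrm s_{\mu+\alpha+m\alpha}[\mathcal L^-_{\mu+\alpha}](\mathsf q),$$ where the limit exists. -/

import Mathlib

open scoped TensorProduct Topology

noncomputable section

namespace RelaxedSl2

attribute [local instance 100] LieRing.ofAssociativeRing

/-! ### The Lie algebra `sl(2)` and its representations -/

/-- The complex Lie algebra `sl(2)` of traceless `2 × 2` matrices. -/
abbrev Sl2 : Type := LieAlgebra.SpecialLinear.sl (Fin 2) ℂ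

/-- The Chevalley generator `e`. -/
def Sl2.e : Sl2 := ⟨!![0, 1; 0, 0], by
  simp [LieAlgebra.SpecialLinear.sl, Matrix.trace, Fin.sum_univ_two]⟩

/-- The Cartan element `h`. -/
def Sl2.h : Sl2 := ⟨!![1, 0; 0, -1], by
  simp [LieAlgebra.SpecialLinear.sl, Matrix.trace, Fin.sum_univ_two]⟩

/-- The Chevalley generator `f`. -/
def Sl2.f : Sl2 := ⟨!![0, 0; 1, 0], by
  simp [LieAlgebra.SpecialLinear.sl, Matrix.trace, Fin.sum_univ_two]⟩

theorem Sl2.trace_eq (x : Sl2) : x.1 1 1 = - x.1 0 0 := by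
  have h := x.2
  have h' : Matrix.trace x.1 = 0 := by
    simpa [LieAlgebra.SpecialLinear.sl] using h
  rw [Matrix.trace, Fin.sum_univ_two] at h'
  simp only [Matrix.diag_apply] at h'
  linear_combination h'

theorem Sl2.coe_lie (x y : Sl2) : (⁅x, y⁆ : Sl2).1 = x.1 * y.1 - y.1 * x.1 := rfl

theorem Sl2.lie_h_e : ⁅Sl2.h, Sl2.e⁆ = (2 : ℂ) • Sl2.e := by
  apply Subtype.ext
  rw [Sl2.coe_lie]
  ext i j
  fin_cases i <;> fin_cases j <;> norm_num [Sl2.h, Sl2.e]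

theorem Sl2.lie_e_f : ⁅Sl2.e, Sl2.f⁆ = Sl2.h := by
  apply Subtype.ext
  rw [Sl2.coe_lie]
  ext i j
  fin_cases i <;> fin_cases j <;> norm_num [Sl2.h, Sl2.e, Sl2.f]

theorem Sl2.lie_h_f : ⁅Sl2.h, Sl2.f⁆ = (-2 : ℂ) • Sl2.f := by
  apply Subtype.ext
  rw [Sl2.coe_lie]
  ext i j
  fin_cases i <;> fin_cases j <;> norm_num [Sl2.h, Sl2.f]

/-- The rescaled Killing form `κ(x, y) = tr (x y)`, so that `κ(h, h) = 2` and
`κ(e, f) = κ(f, e) = 1`. -/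
def killing : Sl2 →ₗ[ℂ] Sl2 →ₗ[ℂ] ℂ :=
  LinearMap.mk₂ ℂ (fun x y => Matrix.trace (x.1 * y.1))
    (by intro x y z; simp [add_mul])
    (by intro c x y; simp)
    (by intro x y z; simp [mul_add])
    (by intro c x y; simp)

theorem killing_apply (x y : Sl2) : killing x y = Matrix.trace (x.1 * y.1) := rfl

theorem killing_symm (x y : Sl2) : killing x y = killing y x := by
  rw [killing_apply, killing_apply, Matrix.trace_mul_comm]

theorem killing_lie (x y z : Sl2) : killing ⁅x, y⁆ z = killing x ⁅y, z⁆ := by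
  rw [killing_apply, killing_apply, Sl2.coe_lie, Sl2.coe_lie, sub_mul, mul_sub,
    Matrix.trace_sub, Matrix.trace_sub, mul_assoc, mul_assoc, Matrix.trace_mul_comm y.1,
    mul_assoc]

/-- The representation of `sl(2)` in which `e`, `h`, `f` act by given operators `E`, `H`, `F`
satisfying the defining relations. -/
def sl2Rep {M : Type*} [AddCommGroup M] [Module ℂ M] (E H F : Module.End ℂ M)
    (hHE : H * E - E * H = (2 : ℂ) • E) (hEF : E * F - F * E = H)
    (hHF : H * F - F * H = (-2 : ℂ) • F) : Sl2 →ₗ⁅ℂ⁆ Module.End ℂ M where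
  toFun x := x.1 0 1 • E + x.1 0 0 • H + x.1 1 0 • F
  map_add' x y := by
    have h : ∀ i j, (x + y).1 i j = x.1 i j + y.1 i j := fun _ _ => rfl
    simp only [h]
    module
  map_smul' c x := by
    have h : ∀ i j, (c • x).1 i j = c * x.1 i j := fun _ _ => rfl
    simp only [h, RingHom.id_apply]
    module
  map_lie' {x y} := by
    have hx := Sl2.trace_eq x
    have hy := Sl2.trace_eq y
    rw [Sl2.coe_lie]
    simp only [Matrix.sub_apply, Matrix.mul_apply, Fin.sum_univ_two, hx, hy, Ring.lie_def]
    have h1 : H * E = E * H + (2 : ℂ) • E := by rw [← hHE]; abel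
    have h2 : F * E = E * F - H := by rw [← hEF]; abel
    have h3 : H * F = F * H + (-2 : ℂ) • F := by rw [← hHF]; abel
    simp only [mul_add, add_mul, smul_mul_assoc, mul_smul_comm, h1, h2, h3]
    module

/-! ### The affine Kac-Moody algebra -/

/-- The untwisted affine Kac-Moody algebra `sl(2) ⊗ ℂ[t, t⁻¹] ⊕ ℂ K ⊕ ℂ L₀`.  The loop part
`∑ xₙ ⊗ tⁿ` is recorded as the finitely supported function `n ↦ xₙ`; `central` and `energy` are the
coefficients of `K` and `L₀`. -/
@[ext] structure AffineSl2 : Type where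
  loop : ℤ →₀ Sl2
  central : ℂ
  energy : ℂ

/-- The Lie bracket `[x tᵐ, y tⁿ] = [x, y] tᵐ⁺ⁿ` of the loop algebra. -/
def loopBracket : (ℤ →₀ Sl2) →ₗ[ℂ] (ℤ →₀ Sl2) →ₗ[ℂ] (ℤ →₀ Sl2) :=
  LinearMap.mk₂ ℂ (fun x y => x.sum fun m u => y.sum fun n v => Finsupp.single (m + n) ⁅u, v⁆)
    (by
      intro x x' y
      rw [Finsupp.sum_add_index'] <;> intros <;> simp [Finsupp.sum_add])
    (by
      intro c x y
      rw [Finsupp.sum_smul_index' (by simp), Finsupp.smul_sum]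
      simp only [Finsupp.smul_sum, smul_lie, Finsupp.smul_single])
    (by
      intro x y y'
      rw [← Finsupp.sum_add]
      congr 1
      ext m u : 2
      rw [Finsupp.sum_add_index'] <;> intros <;> simp)
    (by
      intro c x y
      rw [Finsupp.smul_sum]
      congr 1
      ext m u : 2
      rw [Finsupp.sum_smul_index' (by simp), Finsupp.smul_sum]
      simp only [lie_smul, Finsupp.smul_single])

/-- The cocycle `(x tᵐ, y tⁿ) ↦ m δ_{m+n,0} κ(x, y)` of the loop algebra. -/
def loopCocycle : (ℤ →₀ Sl2) →ₗ[ℂ] (ℤ →₀ Sl2) →ₗ[ℂ] ℂ :=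
  LinearMap.mk₂ ℂ (fun x y => x.sum fun m u => (m : ℂ) * killing u (y (-m)))
    (by
      intro x x' y
      rw [Finsupp.sum_add_index'] <;> intros <;> simp [mul_add])
    (by
      intro c x y
      rw [Finsupp.sum_smul_index' (by simp), Finsupp.smul_sum]
      congr 1
      ext m u
      simp only [map_smul, LinearMap.smul_apply, smul_eq_mul]
      ring)
    (by
      intro x y y'
      rw [← Finsupp.sum_add]
      congr 1
      ext m u
      simp [mul_add])
    (by
      intro c x y
      rw [Finsupp.smul_sum]
      congr 1
      ext m u
      simp only [Finsupp.smul_apply, map_smul, smul_eq_mul]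
      ring)

/-- The derivation `x tⁿ ↦ -n x tⁿ` of the loop algebra. -/
def loopDeriv : (ℤ →₀ Sl2) →ₗ[ℂ] (ℤ →₀ Sl2) :=
  Finsupp.lsum ℂ fun n => (-(n : ℂ)) • Finsupp.lsingle n

theorem loopBracket_single (m n : ℤ) (x y : Sl2) :
    loopBracket (Finsupp.single m x) (Finsupp.single n y) = Finsupp.single (m + n) ⁅x, y⁆ := by
  simp [loopBracket]

theorem loopCocycle_single (m n : ℤ) (x y : Sl2) :
    loopCocycle (Finsupp.single m x) (Finsupp.single n y) =
      if m + n = 0 then (m : ℂ) * killing x y else 0 := by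
  by_cases h : m + n = 0
  · have : -m = n := by omega
    simp [loopCocycle, h, this]
  · have : ¬ n = -m := by omega
    simp [loopCocycle, h, this]

theorem loopDeriv_single (n : ℤ) (x : Sl2) :
    loopDeriv (Finsupp.single n x) = Finsupp.single n ((-(n : ℂ)) • x) := by
  simp [loopDeriv]

theorem loopDeriv_apply (x : ℤ →₀ Sl2) (n : ℤ) : loopDeriv x n = (-(n : ℂ)) • x n := by
  induction x using Finsupp.induction_linear with
  | zero => simp
  | add x y hx hy => simp only [map_add, Finsupp.add_apply, hx, hy, smul_add]
  | single m u =>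
    rw [loopDeriv_single]
    by_cases h : m = n
    · subst h; simp
    · simp [Finsupp.single_apply, h]

theorem loopBracket_skew (x y : ℤ →₀ Sl2) : loopBracket x y = - loopBracket y x := by
  induction x using Finsupp.induction_linear with
  | zero => simp
  | add x x' hx hx' => simp only [map_add, LinearMap.add_apply, hx, hx', neg_add]
  | single m u =>
    induction y using Finsupp.induction_linear with
    | zero => simp
    | add y y' hy hy' => simp only [map_add, LinearMap.add_apply, hy, hy', neg_add]
    | single n v =>
      rw [loopBracket_single, loopBracket_single, add_comm n m, ← lie_skew, Finsupp.single_neg]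

theorem loopCocycle_skew (x y : ℤ →₀ Sl2) : loopCocycle x y = - loopCocycle y x := by
  induction x using Finsupp.induction_linear with
  | zero => simp
  | add x x' hx hx' => simp only [map_add, LinearMap.add_apply, hx, hx', neg_add]
  | single m u =>
    induction y using Finsupp.induction_linear with
    | zero => simp
    | add y y' hy hy' => simp only [map_add, LinearMap.add_apply, hy, hy', neg_add]
    | single n v =>
      rw [loopCocycle_single, loopCocycle_single, add_comm n m, killing_symm v u]
      split_ifs with h
      · have : (m : ℂ) + n = 0 := by exact_mod_cast h
        linear_combination killing u v * this
      · simp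

theorem loopBracket_jacobi (x y z : ℤ →₀ Sl2) :
    loopBracket x (loopBracket y z) =
      loopBracket (loopBracket x y) z + loopBracket y (loopBracket x z) := by
  induction x using Finsupp.induction_linear with
  | zero => simp
  | add x x' hx hx' => simp only [map_add, LinearMap.add_apply, hx, hx']; abel
  | single m u =>
    induction y using Finsupp.induction_linear with
    | zero => simp
    | add y y' hy hy' => simp only [map_add, LinearMap.add_apply, hy, hy']; abel
    | single n v =>
      induction z using Finsupp.induction_linear with
      | zero => simp
      | add z z' hz hz' => simp only [map_add, hz, hz']; abel
      | single p w =>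
        simp only [loopBracket_single]
        rw [show n + (m + p) = m + (n + p) by ring, show m + n + p = m + (n + p) by ring,
          ← Finsupp.single_add, leibniz_lie]

theorem loopCocycle_jacobi (x y z : ℤ →₀ Sl2) :
    loopCocycle x (loopBracket y z) =
      loopCocycle (loopBracket x y) z + loopCocycle y (loopBracket x z) := by
  induction x using Finsupp.induction_linear with
  | zero => simp
  | add x x' hx hx' => simp only [map_add, LinearMap.add_apply, hx, hx']; ring
  | single m u =>
    induction y using Finsupp.induction_linear with
    | zero => simp
    | add y y' hy hy' => simp only [map_add, LinearMap.add_apply, hy, hy']; ring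
    | single n v =>
      induction z using Finsupp.induction_linear with
      | zero => simp
      | add z z' hz hz' => simp only [map_add, hz, hz']; ring
      | single p w =>
        simp only [loopBracket_single, loopCocycle_single]
        rw [show n + (m + p) = m + (n + p) by ring, show m + n + p = m + (n + p) by ring]
        have h1 : killing ⁅u, v⁆ w = killing u ⁅v, w⁆ := killing_lie u v w
        have h2 : killing v ⁅u, w⁆ = - killing u ⁅v, w⁆ := by
          rw [← killing_lie, ← lie_skew v u, map_neg, LinearMap.neg_apply, killing_lie]
        rw [h1, h2]
        split_ifs with h
        · push_cast; ring
        · simp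

theorem loopDeriv_bracket (x y : ℤ →₀ Sl2) :
    loopDeriv (loopBracket x y) = loopBracket (loopDeriv x) y + loopBracket x (loopDeriv y) := by
  induction x using Finsupp.induction_linear with
  | zero => simp
  | add x x' hx hx' => simp only [map_add, LinearMap.add_apply, hx, hx']; abel
  | single m u =>
    induction y using Finsupp.induction_linear with
    | zero => simp
    | add y y' hy hy' => simp only [map_add, hy, hy']; abel
    | single n v =>
      simp only [loopBracket_single, loopDeriv_single, smul_lie, lie_smul]
      rw [← Finsupp.single_add]
      congr 1
      push_cast
      module

theorem loopDeriv_cocycle (x y : ℤ →₀ Sl2) :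
    loopCocycle (loopDeriv x) y + loopCocycle x (loopDeriv y) = 0 := by
  induction x using Finsupp.induction_linear with
  | zero => simp
  | add x x' hx hx' =>
    simp only [map_add, LinearMap.add_apply]
    linear_combination hx + hx'
  | single m u =>
    induction y using Finsupp.induction_linear with
    | zero => simp
    | add y y' hy hy' =>
      simp only [map_add]
      linear_combination hy + hy'
    | single n v =>
      simp only [loopCocycle_single, loopDeriv_single, map_smul, LinearMap.smul_apply, smul_eq_mul]
      split_ifs with h
      · have : (m : ℂ) + n = 0 := by exact_mod_cast h
        linear_combination (-(m : ℂ) * killing u v) * this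
      · simp

namespace AffineSl2

/-- The underlying vector space. -/
def toProd : AffineSl2 ≃ (ℤ →₀ Sl2) × ℂ × ℂ where
  toFun x := (x.loop, x.central, x.energy)
  invFun p := ⟨p.1, p.2.1, p.2.2⟩
  left_inv _ := rfl
  right_inv _ := rfl

instance : AddCommGroup AffineSl2 := toProd.addCommGroup

instance : Module ℂ AffineSl2 := toProd.module ℂ

theorem zero_loop : (0 : AffineSl2).loop = 0 := rfl
theorem zero_central : (0 : AffineSl2).central = 0 := rfl
theorem zero_energy : (0 : AffineSl2).energy = 0 := rfl
theorem add_loop (x y : AffineSl2) : (x + y).loop = x.loop + y.loop := rfl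
theorem add_central (x y : AffineSl2) : (x + y).central = x.central + y.central := rfl
theorem add_energy (x y : AffineSl2) : (x + y).energy = x.energy + y.energy := rfl
theorem smul_loop (c : ℂ) (x : AffineSl2) : (c • x).loop = c • x.loop := rfl
theorem smul_central (c : ℂ) (x : AffineSl2) : (c • x).central = c * x.central := rfl
theorem smul_energy (c : ℂ) (x : AffineSl2) : (c • x).energy = c * x.energy := rfl

/-- The Lie bracket: `[xₘ, yₙ] = [x, y]ₘ₊ₙ + m δ_{m+n,0} κ(x, y) K`, `[L₀, xₙ] = -n xₙ`, and `K` is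
central. -/
instance : Bracket AffineSl2 AffineSl2 where
  bracket x y :=
    ⟨loopBracket x.loop y.loop + x.energy • loopDeriv y.loop - y.energy • loopDeriv x.loop,
      loopCocycle x.loop y.loop, 0⟩

theorem lie_loop (x y : AffineSl2) : ⁅x, y⁆.loop =
    loopBracket x.loop y.loop + x.energy • loopDeriv y.loop - y.energy • loopDeriv x.loop := rfl
theorem lie_central (x y : AffineSl2) : ⁅x, y⁆.central = loopCocycle x.loop y.loop := rfl
theorem lie_energy (x y : AffineSl2) : ⁅x, y⁆.energy = 0 := rfl

instance : LieRing AffineSl2 where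
  add_lie x y z := by
    ext1
    · simp only [lie_loop, add_loop, add_energy, map_add, LinearMap.add_apply]
      module
    · simp only [lie_central, add_loop, add_central, map_add, LinearMap.add_apply]
    · simp only [lie_energy, add_energy, add_zero]
  lie_add x y z := by
    ext1
    · simp only [lie_loop, add_loop, add_energy, map_add]
      module
    · simp only [lie_central, add_loop, add_central, map_add]
    · simp only [lie_energy, add_energy, add_zero]
  lie_self x := by
    ext1
    · have h := loopBracket_skew x.loop x.loop
      have h' : loopBracket x.loop x.loop = 0 := by
        have h2 : (2 : ℂ) • loopBracket x.loop x.loop = 0 := by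
          rw [two_smul]; exact add_eq_zero_iff_eq_neg.mpr h
        exact (smul_eq_zero.mp h2).resolve_left two_ne_zero
      simp only [lie_loop, h', zero_loop]
      module
    · have h := loopCocycle_skew x.loop x.loop
      have h' : loopCocycle x.loop x.loop = 0 := self_eq_neg.mp h
      simp only [lie_central, h', zero_central]
    · rfl
  leibniz_lie x y z := by
    ext1
    · simp only [lie_loop, add_loop, lie_energy, map_add, map_sub, map_smul, LinearMap.add_apply,
        LinearMap.sub_apply, LinearMap.smul_apply, loopDeriv_bracket]
      rw [loopBracket_jacobi x.loop y.loop z.loop, loopBracket_skew y.loop (loopDeriv x.loop)]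
      module
    · simp only [lie_loop, add_central, lie_central, map_add, map_sub, map_smul,
        LinearMap.add_apply, LinearMap.sub_apply, LinearMap.smul_apply, smul_eq_mul]
      have h1 := loopDeriv_cocycle x.loop y.loop
      have h2 := loopDeriv_cocycle x.loop z.loop
      have h3 := loopDeriv_cocycle y.loop z.loop
      have h4 := loopCocycle_skew y.loop (loopDeriv x.loop)
      rw [loopCocycle_jacobi x.loop y.loop z.loop]
      linear_combination y.energy * h2 - x.energy * h3 + z.energy * h4 - z.energy * h1
    · simp only [lie_energy, add_energy, add_zero]

instance : LieAlgebra ℂ AffineSl2 where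
  lie_smul c x y := by
    ext1
    · simp only [lie_loop, smul_loop, smul_energy, map_smul]
      module
    · simp only [lie_central, smul_loop, smul_central, map_smul, smul_eq_mul]
    · simp only [lie_energy, smul_energy, mul_zero]

/-- The mode `xₙ = x ⊗ tⁿ`. -/
def mode (x : Sl2) (n : ℤ) : AffineSl2 := ⟨Finsupp.single n x, 0, 0⟩

/-- The central element `K`. -/
def K : AffineSl2 := ⟨0, 1, 0⟩

/-- The derivation `L₀`. -/
def L0 : AffineSl2 := ⟨0, 0, 1⟩

end AffineSl2

theorem loopBracket_apply_of_nonneg (x y : ℤ →₀ Sl2) (hx : ∀ n < 0, x n = 0)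
    (hy : ∀ n < 0, y n = 0) (n : ℤ) (hn : n ≤ 0) :
    loopBracket x y n = if n = 0 then ⁅x 0, y 0⁆ else 0 := by
  change (x.sum fun m u => y.sum fun p v => Finsupp.single (m + p) ⁅u, v⁆) n = _
  rw [Finsupp.sum_apply]
  simp only [Finsupp.sum_apply]
  have key : ∀ m p : ℤ, (Finsupp.single (m + p) ⁅x m, y p⁆ : ℤ →₀ Sl2) n =
      if m = 0 ∧ p = 0 ∧ n = 0 then ⁅x 0, y 0⁆ else 0 := by
    intro m p
    by_cases hm : m < 0
    · rw [hx m hm, if_neg (by omega)]; simp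
    by_cases hp : p < 0
    · rw [hy p hp, if_neg (by omega)]; simp
    by_cases h : m + p = n
    · have h1 : m = 0 := by omega
      have h2 : p = 0 := by omega
      have h3 : n = 0 := by omega
      subst h1 h2 h3
      simp
    · rw [if_neg (by omega), Finsupp.single_apply, if_neg h]
  simp only [Finsupp.sum, key]
  by_cases h : n = 0
  · subst h
    rw [if_pos rfl]
    by_cases h1 : x 0 = 0
    · simp [h1]
    by_cases h2 : y 0 = 0
    · simp [h2]
    rw [Finset.sum_eq_single 0, Finset.sum_eq_single 0]
    · simp
    · intro p _ hp; simp [hp]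
    · intro h3; simp [h2] at h3
    · intro m _ hm; simp [hm]
    · intro h3; simp [h1] at h3
  · simp [h]

theorem loopCocycle_eq_zero_of_nonneg (x y : ℤ →₀ Sl2) (hx : ∀ n < 0, x n = 0)
    (hy : ∀ n < 0, y n = 0) : loopCocycle x y = 0 := by
  change (x.sum fun m u => (m : ℂ) * killing u (y (-m))) = 0
  refine Finset.sum_eq_zero fun m _ => ?_
  rcases lt_trichotomy m 0 with h | h | h
  · simp [hx m h]
  · simp [h]
  · simp [hy (-m) (by omega)]

/-- The subalgebra spanned by `K`, `L₀` and the modes `xₙ` with `n ≥ 0`. -/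
def affineGe : LieSubalgebra ℂ AffineSl2 where
  carrier := {x | ∀ n < 0, x.loop n = 0}
  zero_mem' := by intro n _; rfl
  add_mem' := by
    intro x y hx hy n hn
    rw [AffineSl2.add_loop, Finsupp.add_apply, hx n hn, hy n hn, add_zero]
  smul_mem' := by
    intro c x hx n hn
    rw [AffineSl2.smul_loop, Finsupp.smul_apply, hx n hn, smul_zero]
  lie_mem' := by
    intro x y hx hy n hn
    rw [AffineSl2.lie_loop, Finsupp.sub_apply, Finsupp.add_apply, Finsupp.smul_apply,
      Finsupp.smul_apply, loopDeriv_apply, loopDeriv_apply, hx n hn, hy n hn,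
      loopBracket_apply_of_nonneg _ _ hx hy n hn.le, if_neg hn.ne]
    simp

/-- The extension of a representation `ρ` of `sl(2)` to the subalgebra of non-negative modes: the
zero modes act through `ρ`, the positive modes act as zero, and `K` and `L₀` act as
multiplication by `k` and `Δ`. -/
def inflate {M : Type*} [AddCommGroup M] [Module ℂ M] (k Δ : ℂ) (ρ : Sl2 →ₗ⁅ℂ⁆ Module.End ℂ M) :
    affineGe →ₗ⁅ℂ⁆ Module.End ℂ M where
  toFun x := ρ (x.1.loop 0) + (x.1.central * k + x.1.energy * Δ) • (1 : Module.End ℂ M)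
  map_add' x y := by
    have h : (x + y).1 = x.1 + y.1 := rfl
    simp only [h, AffineSl2.add_loop, AffineSl2.add_central,
      AffineSl2.add_energy, Finsupp.add_apply, map_add]
    module
  map_smul' c x := by
    have h : (c • x).1 = c • x.1 := rfl
    simp only [h, AffineSl2.smul_loop, AffineSl2.smul_central,
      AffineSl2.smul_energy, Finsupp.smul_apply, map_smul, RingHom.id_apply]
    module
  map_lie' {x y} := by
    have h0 : (⁅x, y⁆ : affineGe).1.loop 0 = ⁅x.1.loop 0, y.1.loop 0⁆ := by
      rw [LieSubalgebra.coe_bracket, AffineSl2.lie_loop, Finsupp.sub_apply, Finsupp.add_apply,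
        Finsupp.smul_apply, Finsupp.smul_apply, loopDeriv_apply, loopDeriv_apply,
        loopBracket_apply_of_nonneg _ _ x.2 y.2 0 le_rfl]
      simp
    have h1 : (⁅x, y⁆ : affineGe).1.central = 0 := by
      rw [LieSubalgebra.coe_bracket, AffineSl2.lie_central,
        loopCocycle_eq_zero_of_nonneg _ _ x.2 y.2]
    have h2 : (⁅x, y⁆ : affineGe).1.energy = 0 := rfl
    rw [h0, h1, h2, LieHom.map_lie, Ring.lie_def, Ring.lie_def]
    simp only [mul_add, add_mul, smul_mul_assoc, mul_smul_comm, one_mul, mul_one]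
    module

/-! ### Modules over the affine algebra

A module over the affine algebra is the same thing as a left module over its universal enveloping
algebra. -/

/-- The universal enveloping algebra of the affine algebra. -/
abbrev UAff : Type := UniversalEnvelopingAlgebra ℂ AffineSl2

/-- The canonical map from the affine algebra to its universal enveloping algebra. -/
abbrev toU (x : AffineSl2) : UAff := UniversalEnvelopingAlgebra.ι ℂ x

section RelaxedVerma

variable {M : Type} [AddCommGroup M] [Module ℂ M]

/-- The submodule of `U ⊗ M`, for `U` the enveloping algebra, spanned by the
`u x ⊗ m - u ⊗ x m` with `x` in the subalgebra of non-negative modes. -/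
def balancing (k Δ : ℂ) (ρ : Sl2 →ₗ⁅ℂ⁆ Module.End ℂ M) : Submodule UAff (UAff ⊗[ℂ] M) :=
  Submodule.span UAff {z | ∃ (u : UAff) (x : affineGe) (m : M),
    z = (u * toU x.1) ⊗ₜ[ℂ] m - u ⊗ₜ[ℂ] (inflate k Δ ρ x m)}

/-- The relaxed Verma module of level `k` and conformal weight `Δ` induced from the
`sl(2)`-module `(M, ρ)`: the tensor product of the enveloping algebra with `M` over the enveloping
algebra of the subalgebra of non-negative modes. -/
abbrev RelaxedVerma (k Δ : ℂ) (ρ : Sl2 →ₗ⁅ℂ⁆ Module.End ℂ M) : Type :=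
  (UAff ⊗[ℂ] M) ⧸ balancing k Δ ρ

/-- The natural map `m ↦ 1 ⊗ m` from the inducing module to the relaxed Verma module. -/
def groundMap (k Δ : ℂ) (ρ : Sl2 →ₗ⁅ℂ⁆ Module.End ℂ M) : M →ₗ[ℂ] RelaxedVerma k Δ ρ :=
  ((balancing k Δ ρ).mkQ.restrictScalars ℂ) ∘ₗ (TensorProduct.mk ℂ UAff M 1)

/-- The space of ground states of a relaxed Verma module, which is the image of the inducing
module. -/
def groundStates (k Δ : ℂ) (ρ : Sl2 →ₗ⁅ℂ⁆ Module.End ℂ M) : Submodule ℂ (RelaxedVerma k Δ ρ) :=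
  LinearMap.range (groundMap k Δ ρ)

/-- The sum of the submodules of a relaxed Verma module that have zero intersection with the
space of ground states. -/
def nonGroundSum (k Δ : ℂ) (ρ : Sl2 →ₗ⁅ℂ⁆ Module.End ℂ M) :
    Submodule UAff (RelaxedVerma k Δ ρ) :=
  sSup {N | N.restrictScalars ℂ ⊓ groundStates k Δ ρ = ⊥}

end RelaxedVerma

/-- The simple root `α` of `sl(2)`.  Elements `μ` of `𝔥*` are identified with complex numbers through
their Dynkin labels `μ(h)`. -/
abbrev simpleRoot : ℂ := 2

section StringFunctions

variable (V : Type) [AddCommGroup V] [Module UAff V] [Module ℂ V] [IsScalarTower ℂ UAff V]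

/-- The operator by which an element of the affine algebra acts on a module. -/
def act (x : AffineSl2) : Module.End ℂ V := Algebra.lsmul ℂ ℂ V (toU x)

/-- The weight space `V(μ, n)`: the vectors of `sl(2)`-weight `μ` (eigenvectors of `h₀`) and
conformal weight `n` (generalised eigenvectors of `L₀`).  An element `μ` of `𝔥*` is identified with
its Dynkin label `μ(h)`. -/
def weightSpace (μ n : ℂ) : Submodule ℂ V :=
  (act V (AffineSl2.mode Sl2.h 0)).eigenspace μ ⊓ (act V AffineSl2.L0).maxGenEigenspace n

/-- A level-`k` weight module: `K` acts as `k`, the module is the sum of its weight spaces, and these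
are finite-dimensional. -/
structure IsWeightModule (k : ℂ) : Prop where
  level : ∀ v : V, toU AffineSl2.K • v = k • v
  iSup_weightSpace : ⨆ μ : ℂ, ⨆ n : ℂ, weightSpace V μ n = ⊤
  finite_weightSpace : ∀ μ n : ℂ, FiniteDimensional ℂ (weightSpace V μ n)

/-- The string function `∑ₙ dim V(μ, n) qⁿ`, a generalised formal power series with exponents
`n ∈ ℂ`, recorded as its coefficient function. -/
def stringFunction (μ : ℂ) : ℂ → ℕ := fun n => Module.finrank ℂ (weightSpace V μ n)

/-- A level-`k` weight module is stringy if its non-zero string functions all coincide. -/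
structure IsStringy (k : ℂ) : Prop where
  isWeightModule : IsWeightModule V k
  eq_of_ne_zero : ∀ μ ν : ℂ, stringFunction V μ ≠ 0 → stringFunction V ν ≠ 0 →
    stringFunction V μ = stringFunction V ν

/-- `S` is the positive limiting string function of `V` along the coset `μ + ℤ α`, with `α`
the simple root: each coefficient of the string function at `μ + m α` converges to the
corresponding coefficient of `S` as `m → ∞`. -/
def HasPosLimit (μ : ℂ) (S : ℂ → ℕ) : Prop :=
  ∀ n : ℂ, Filter.Tendsto (fun m : ℤ => stringFunction V (μ + m * simpleRoot) n) Filter.atTop (𝓝 (S n))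

/-- The quotient of a module by the sum of its proper submodules.  For a module with a unique
maximal proper submodule, this is its unique simple quotient. -/
abbrev SimpleQuotient : Type := V ⧸ sSup {N : Submodule UAff V | N ≠ ⊤}

end StringFunctions

/-! ### Weights, dense modules and lowest-weight modules

Elements of `𝔥*` are identified with complex numbers through their Dynkin labels, so the fundamental
weight and the Weyl vector are `1`, and the simple root is `2`. -/

/-- The root lattice. -/
abbrev rootLattice : AddSubgroup ℂ := AddSubgroup.zmultiples simpleRoot

/-- The Weyl vector `ρ`. -/
abbrev weylVector : ℂ := 1

/-- The bilinear form on `𝔥*`, normalised so that the simple root has norm-squared `2`. -/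
def weightForm (μ ν : ℂ) : ℂ := μ * ν / 2

/-- `μ` is a solution of `⟨μ, μ + 2 ρ⟩ = q`, with `ρ` the Weyl vector. -/
def IsSolution (q μ : ℂ) : Prop := weightForm μ (μ + 2 * weylVector) = q

/-- The set `Λ_q` of cosets of the root lattice that contain a solution of `⟨μ, μ + 2 ρ⟩ = q`. -/
def nonsimpleCosets (q : ℂ) : Set (ℂ ⧸ rootLattice) :=
  {lam | ∃ μ : ℂ, (μ : ℂ ⧸ rootLattice) = lam ∧ IsSolution q μ}

/-- The square roots of `1 + 2 q` are integers. -/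
def SqrtIsInt (q : ℂ) : Prop := ∃ r : ℤ, (r : ℂ) ^ 2 = 1 + 2 * q

/-- `μ` is a solution of `⟨μ, μ + 2 ρ⟩ = q` and, if the square roots of `1 + 2 q` are integers, it is
the maximal one (with respect to the real part of the Dynkin label). -/
def IsPreferredSolution (q μ : ℂ) : Prop :=
  IsSolution q μ ∧ (SqrtIsInt q → ∀ μ' : ℂ, IsSolution q μ' → μ'.re ≤ μ.re)

/-- The weights in a coset. -/
abbrev CosetWeights (lam : ℂ ⧸ rootLattice) : Type := {μ : ℂ // (μ : ℂ ⧸ rootLattice) = lam}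

/-- Translation of the weights in a coset by the simple root. -/
def CosetWeights.up {lam : ℂ ⧸ rootLattice} (μ : CosetWeights lam) : CosetWeights lam :=
  ⟨μ.1 + simpleRoot, by
    refine Eq.trans (QuotientAddGroup.eq.mpr ?_) μ.2
    rw [AddSubgroup.mem_zmultiples_iff]
    exact ⟨-1, by simp⟩⟩

/-- Translation of the weights in a coset by minus the simple root. -/
def CosetWeights.down {lam : ℂ ⧸ rootLattice} (μ : CosetWeights lam) : CosetWeights lam :=
  ⟨μ.1 - simpleRoot, by
    refine Eq.trans (QuotientAddGroup.eq.mpr ?_) μ.2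
    rw [AddSubgroup.mem_zmultiples_iff]
    exact ⟨1, by simp⟩⟩

theorem CosetWeights.down_up {lam : ℂ ⧸ rootLattice} (μ : CosetWeights lam) : μ.up.down = μ :=
  Subtype.ext (by simp [CosetWeights.up, CosetWeights.down])

theorem CosetWeights.up_down {lam : ℂ ⧸ rootLattice} (μ : CosetWeights lam) : μ.down.up = μ :=
  Subtype.ext (by simp [CosetWeights.up, CosetWeights.down])

/-- The coefficient `γ_μ = (q - ⟨μ, μ + 2 ρ⟩) / 2`. -/
def gam (q μ : ℂ) : ℂ := (q - weightForm μ (μ + 2 * weylVector)) / 2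

/-- The dense `sl(2)`-module of Casimir eigenvalue `q` with weight support `lam` on which `f` acts
injectively.  It has a basis `v_μ`, for `μ` in `lam`, with
`e v_μ = γ_μ v_{μ+α}`, `h v_μ = μ(h) v_μ` and `f v_μ = v_{μ-α}`. -/
def denseRep (q : ℂ) (lam : ℂ ⧸ rootLattice) :
    Sl2 →ₗ⁅ℂ⁆ Module.End ℂ (CosetWeights lam →₀ ℂ) :=
  sl2Rep
    (Finsupp.linearCombination ℂ fun μ : CosetWeights lam => Finsupp.single μ.up (gam q μ.1))
    (Finsupp.linearCombination ℂ fun μ : CosetWeights lam => Finsupp.single μ μ.1)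
    (Finsupp.linearCombination ℂ fun μ : CosetWeights lam => Finsupp.single μ.down 1)
    (by
      refine Finsupp.lhom_ext fun μ c => ?_
      simp only [Module.End.mul_apply, LinearMap.sub_apply, LinearMap.smul_apply,
        Finsupp.linearCombination_single, Finsupp.smul_single, smul_eq_mul,
        ← Finsupp.single_sub]
      congr 1
      simp only [CosetWeights.up]
      ring)
    (by
      refine Finsupp.lhom_ext fun μ c => ?_
      simp only [Module.End.mul_apply, LinearMap.sub_apply,
        Finsupp.linearCombination_single, Finsupp.smul_single, smul_eq_mul,
        CosetWeights.down_up, CosetWeights.up_down, ← Finsupp.single_sub]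
      congr 1
      simp only [CosetWeights.down, gam, weightForm]
      ring)
    (by
      refine Finsupp.lhom_ext fun μ c => ?_
      simp only [Module.End.mul_apply, LinearMap.sub_apply, LinearMap.smul_apply,
        Finsupp.linearCombination_single, Finsupp.smul_single, smul_eq_mul,
        ← Finsupp.single_sub]
      congr 1
      simp only [CosetWeights.down]
      ring)

/-- The lowest-weight Verma `sl(2)`-module of lowest weight `ν`.  It has a basis `w_j = eʲ w₀`,
`j ≥ 0`, where `h w₀ = ν(h) w₀` and `f w₀ = 0`. -/
def lowestVermaRep (ν : ℂ) : Sl2 →ₗ⁅ℂ⁆ Module.End ℂ (ℕ →₀ ℂ) :=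
  sl2Rep
    (Finsupp.linearCombination ℂ fun j => Finsupp.single (j + 1) 1)
    (Finsupp.linearCombination ℂ fun j => Finsupp.single j (ν + 2 * j))
    (Finsupp.linearCombination ℂ fun j => Finsupp.single (j - 1) (-(j * (ν + j - 1))))
    (by
      refine Finsupp.lhom_ext fun j c => ?_
      simp only [Module.End.mul_apply, LinearMap.sub_apply, LinearMap.smul_apply,
        Finsupp.linearCombination_single, Finsupp.smul_single, smul_eq_mul,
        ← Finsupp.single_sub]
      congr 1
      push_cast
      ring)
    (by
      refine Finsupp.lhom_ext fun j c => ?_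
      simp only [Module.End.mul_apply, LinearMap.sub_apply,
        Finsupp.linearCombination_single, Finsupp.smul_single, smul_eq_mul]
      rcases j with _ | j
      · simp
      · simp only [Nat.add_sub_cancel, ← Finsupp.single_sub]
        congr 1
        push_cast
        ring)
    (by
      refine Finsupp.lhom_ext fun j c => ?_
      simp only [Module.End.mul_apply, LinearMap.sub_apply, LinearMap.smul_apply,
        Finsupp.linearCombination_single, Finsupp.smul_single, smul_eq_mul]
      rcases j with _ | j
      · simp
      · simp only [Nat.add_sub_cancel, ← Finsupp.single_sub]
        congr 1
        push_cast
        ring)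

/-- The relaxed highest-weight module `E_{lam;q}` of level `k` and conformal weight `Δ`: the relaxed
Verma module induced from the dense module, modulo the sum of its submodules that have zero
intersection with the ground states. -/
abbrev RelaxedModule (k Δ q : ℂ) (lam : ℂ ⧸ rootLattice) : Type :=
  RelaxedVerma k Δ (denseRep q lam) ⧸ nonGroundSum k Δ (denseRep q lam)

/-- The simple module `L⁻_ν` of level `k` and conformal weight `Δ`: the simple quotient of the
relaxed Verma module induced from the lowest-weight Verma module of lowest weight `ν`. -/
abbrev SimpleLowest (k Δ ν : ℂ) : Type := SimpleQuotient (RelaxedVerma k Δ (lowestVermaRep ν))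

end RelaxedSl2

end

/-! Let U be the enveloping algebra. Realising the induced module on U(a) ⊗ M, with a the span of
the negative modes, and applying the augmentation of U(a) gives a projection `groundProj` onto M
that kills every image of a negative mode. A polynomial in L₀ extracts the ground component of a
given vector (`exists_smul_eq_groundMap`). Hence the sum of the submodules avoiding the ground
states is the radical, the set of v with `groundProj (u • v) = 0` for all u in U
(`nonGroundSum_eq_radical`).

Fix the conformal weight Δ + n. The weight space of weight μ is spanned by the words of degree n,
each applied to the basis vector that makes the total weight μ; there are finitely many of them, and
their number does not depend on μ. The relations among them modulo the radical form the kernel of a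
matrix with entries polynomial in μ, because γ is polynomial in the weight (`wordComb_mem_radical`).
So outside a finite set of μ the dimension is constant, and finitely many rows already cut out the
kernel (`exists_generic_polyKer`).

Since f is injective on the dense module and ad f is locally nilpotent on U, f is also injective on
the quotient by the radical (`mem_radical_of_f_smul`). Dimensions therefore grow weakly down a
coset. Both far up and far down they have the generic value, so they have it everywhere
(`finrank_weightSpace_dense_eq`), and the module is stringy.

For a solution μ one has e v_μ = 0, so the v_ν with ν in μ - ℕα span a submodule of the dense module
of the coset of μ. For a preferred μ (`ne_zero_of_isPreferredSolution`) the quotient is the simple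
lowest-weight Verma module of lowest weight μ + α. The sum of the proper submodules of its induced
module is again the radical (`sSup_proper_eq_radical`), and its ground components are, up to nonzero
scalars, the dense ones at weights above μ. At μ + α + mα with m large, every word meets an existing
basis vector and the finitely many decisive rows are all visible, so the relations are the generic
ones (`finrank_weightSpace_lowest`). The generic dimension does not depend on the coset, so μ may
lie outside λ. -/

noncomputable section

namespace RelaxedSl2

attribute [local instance 100] LieRing.ofAssociativeRing

/-! ### Induction from one of two complementary subalgebras -/

section Splitting

variable {R L : Type*} [CommRing R] [LieRing L] [LieAlgebra R L]

/-- A decomposition of a Lie algebra as the direct sum of two subalgebras. -/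
structure LieSplitting (a b : LieSubalgebra R L) where
  fst : L →ₗ[R] a
  snd : L →ₗ[R] b
  fst_add_snd : ∀ x, (fst x : L) + snd x = x
  fst_coe : ∀ x : a, fst x = x
  snd_coe : ∀ x : b, snd x = x

/-- An element of the enveloping algebra maps a submodule to itself if the Lie algebra does. -/
theorem envelope_smul_mem {V : Type*} [AddCommGroup V] [Module R V]
    [Module (UniversalEnvelopingAlgebra R L) V] [IsScalarTower R (UniversalEnvelopingAlgebra R L) V]
    (S : Submodule R V)
    (hS : ∀ (x : L), ∀ v ∈ S, UniversalEnvelopingAlgebra.ι R x • v ∈ S)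
    (u : UniversalEnvelopingAlgebra R L) : ∀ v ∈ S, u • v ∈ S := by
  let A : Subalgebra R (UniversalEnvelopingAlgebra R L) :=
    { carrier := {u | ∀ v ∈ S, u • v ∈ S}
      mul_mem' := fun {a b} ha hb v hv => by rw [mul_smul]; exact ha _ (hb _ hv)
      add_mem' := fun {a b} ha hb v hv => by rw [add_smul]; exact S.add_mem (ha _ hv) (hb _ hv)
      algebraMap_mem' := fun r v hv => by
        rw [algebraMap_smul]; exact S.smul_mem r hv }
  let g : L →ₗ⁅R⁆ A :=
    { toFun := fun x => ⟨UniversalEnvelopingAlgebra.ι R x, hS x⟩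
      map_add' := fun x y => Subtype.ext (map_add _ x y)
      map_smul' := fun c x => Subtype.ext (map_smul _ c x)
      map_lie' := fun {x y} => Subtype.ext (LieHom.map_lie _ x y) }
  -- By the universal property, lifting the Lie algebra into the stabiliser `A` and including back
  -- is the identity, so `A` is the whole enveloping algebra.
  have h : A.val.comp (UniversalEnvelopingAlgebra.lift R g) =
      AlgHom.id R (UniversalEnvelopingAlgebra R L) := by
    apply UniversalEnvelopingAlgebra.hom_ext
    ext x
    simp only [LieHom.comp_apply, AlgHom.coe_toLieHom, AlgHom.comp_apply,
      UniversalEnvelopingAlgebra.lift_ι_apply, AlgHom.id_apply]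
    rfl
  have h2 := DFunLike.congr_fun h u
  intro v hv
  have h3 := (UniversalEnvelopingAlgebra.lift R g u).2 v hv
  have h4 : ((UniversalEnvelopingAlgebra.lift R g u : A) : UniversalEnvelopingAlgebra R L) = u := h2
  rwa [h4] at h3

/-- A property of elements of the enveloping algebra that holds for `1` and is stable under linear
combinations and under left multiplication by the Lie algebra holds for all elements. -/
theorem envelope_induction (S : Submodule R (UniversalEnvelopingAlgebra R L)) (h1 : 1 ∈ S)
    (hS : ∀ (x : L), ∀ v ∈ S, UniversalEnvelopingAlgebra.ι R x * v ∈ S)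
    (u : UniversalEnvelopingAlgebra R L) : u ∈ S := by
  have := envelope_smul_mem S hS u 1 h1
  rwa [smul_eq_mul, mul_one] at this

namespace LieSplitting

variable {a b : LieSubalgebra R L} (s : LieSplitting a b)

theorem snd_of_mem {x : L} (hx : x ∈ a) : s.snd x = 0 := by
  have h1 := s.fst_add_snd x
  have h2 : s.fst x = ⟨x, hx⟩ := s.fst_coe ⟨x, hx⟩
  rw [h2] at h1
  exact Subtype.ext (by simpa using h1)

theorem fst_of_mem {x : L} (hx : x ∈ b) : s.fst x = 0 := by
  have h1 := s.fst_add_snd x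
  have h2 : s.snd x = ⟨x, hx⟩ := s.snd_coe ⟨x, hx⟩
  rw [h2] at h1
  exact Subtype.ext (by simpa using h1)

variable {W : Type*} [AddCommGroup W] [Module R W]

/-- The map `y ↦ [y, x]`. -/
def bracketRight (b : LieSubalgebra R L) (x : L) : b →ₗ[R] L where
  toFun y := ⁅(y : L), x⁆
  map_add' y z := by simp
  map_smul' c y := by simp

/-- The operator on `W × Hom(b, W)` that describes how an element `x` of `a` acts on a vector
together with its images under `b`. -/
def pairOp (l : a →ₗ⁅R⁆ Module.End R W) (x : a) : Module.End R (W × (b →ₗ[R] W)) where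
  toFun p := (l x p.1, l x ∘ₗ p.2 +
    (l : a →ₗ[R] Module.End R W).flip p.1 ∘ₗ s.fst ∘ₗ bracketRight b x +
      p.2 ∘ₗ s.snd ∘ₗ bracketRight b x)
  map_add' p p' := by
    refine Prod.ext (by simp) (LinearMap.ext fun y => ?_)
    simp
    abel
  map_smul' c p := by
    refine Prod.ext (by simp) (LinearMap.ext fun y => ?_)
    simp

theorem pairOp_fst (l : a →ₗ⁅R⁆ Module.End R W) (x : a) (p : W × (b →ₗ[R] W)) :
    (s.pairOp l x p).1 = l x p.1 := rfl

theorem pairOp_snd (l : a →ₗ⁅R⁆ Module.End R W) (x : a) (p : W × (b →ₗ[R] W)) (y : b) :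
    (s.pairOp l x p).2 y = l x (p.2 y) + l (s.fst ⁅(y : L), (x : L)⁆) p.1 +
      p.2 (s.snd ⁅(y : L), (x : L)⁆) := rfl

/-- This and `snd_lie_lie` are the two components of the Jacobi identity along the splitting. They
are exactly what makes `pairOp` compatible with brackets. -/
theorem fst_lie_lie (y : L) (x x' : a) :
    s.fst ⁅y, ⁅(x : L), (x' : L)⁆⁆ =
      ⁅s.fst ⁅y, (x : L)⁆, x'⁆ + s.fst ⁅(s.snd ⁅y, (x : L)⁆ : L), (x' : L)⁆ +
      ⁅x, s.fst ⁅y, (x' : L)⁆⁆ - s.fst ⁅(s.snd ⁅y, (x' : L)⁆ : L), (x : L)⁆ := by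
  rw [leibniz_lie, map_add]
  have h : ∀ z : L, ∀ x' : a, s.fst ⁅z, (x' : L)⁆ =
      ⁅s.fst z, x'⁆ + s.fst ⁅(s.snd z : L), (x' : L)⁆ := by
    intro z x'
    conv_lhs => rw [← s.fst_add_snd z, add_lie, map_add]
    congr 1
    exact s.fst_coe ⁅s.fst z, x'⁆
  rw [h ⁅y, (x : L)⁆ x', ← lie_skew (x : L) ⁅y, (x' : L)⁆, map_neg, h ⁅y, (x' : L)⁆ x,
    ← lie_skew x (s.fst ⁅y, (x' : L)⁆)]
  abel

/-- It expresses that a acts from the right on b ≅ L/a. -/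
theorem snd_lie_lie (y : L) (x x' : a) :
    s.snd ⁅y, ⁅(x : L), (x' : L)⁆⁆ =
      s.snd ⁅(s.snd ⁅y, (x : L)⁆ : L), (x' : L)⁆ - s.snd ⁅(s.snd ⁅y, (x' : L)⁆ : L), (x : L)⁆ := by
  rw [leibniz_lie, map_add]
  have h : ∀ z : L, ∀ x' : a, s.snd ⁅z, (x' : L)⁆ = s.snd ⁅(s.snd z : L), (x' : L)⁆ := by
    intro z x'
    conv_lhs => rw [← s.fst_add_snd z, add_lie, map_add]
    rw [s.snd_of_mem (a.lie_mem (s.fst z).2 x'.2), zero_add]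
  rw [h ⁅y, (x : L)⁆ x', ← lie_skew (x : L) ⁅y, (x' : L)⁆, map_neg, h ⁅y, (x' : L)⁆ x]
  abel

/-- The representation of `a` on `W × Hom(b, W)`. -/
def pairRep (l : a →ₗ⁅R⁆ Module.End R W) : a →ₗ⁅R⁆ Module.End R (W × (b →ₗ[R] W)) where
  toFun := s.pairOp l
  map_add' x x' := by
    refine LinearMap.ext fun p => Prod.ext (by simp [pairOp_fst]) (LinearMap.ext fun y => ?_)
    simp [pairOp_snd]
    abel
  map_smul' c x := by
    refine LinearMap.ext fun p => Prod.ext (by simp [pairOp_fst]) (LinearMap.ext fun y => ?_)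
    simp [pairOp_snd]
  map_lie' {x x'} := by
    refine LinearMap.ext fun p => Prod.ext ?_ (LinearMap.ext fun y => ?_)
    · simp [pairOp_fst, Ring.lie_def]
    · have e1 : ((⁅x, x'⁆ : a) : L) = ⁅(x : L), (x' : L)⁆ := rfl
      rw [pairOp_snd, e1, s.fst_lie_lie, s.snd_lie_lie, Ring.lie_def]
      simp only [LinearMap.sub_apply, Module.End.mul_apply, Prod.snd_sub, pairOp_snd, pairOp_fst,
        map_add, map_sub, LieHom.map_lie, Ring.lie_def, LinearMap.add_apply]
      abel

variable {M : Type*} [AddCommGroup M] [Module R M] (ρ : b →ₗ⁅R⁆ Module.End R M)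

/-- The vector space `U(a) ⊗ M` on which the induced module is realised. -/
abbrev Carrier (a : LieSubalgebra R L) (M : Type*) [AddCommGroup M] [Module R M] : Type _ :=
  UniversalEnvelopingAlgebra R a ⊗[R] M

/-- Left multiplication by elements of `a`. -/
def leftRep (a : LieSubalgebra R L) (M : Type*) [AddCommGroup M] [Module R M] :
    a →ₗ⁅R⁆ Module.End R (Carrier a M) :=
  (Algebra.lsmul R R (Carrier a M)).toLieHom.comp (UniversalEnvelopingAlgebra.ι R)

theorem leftRep_tmul (x : a) (u : UniversalEnvelopingAlgebra R a) (m : M) :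
    leftRep a M x (u ⊗ₜ m) = (UniversalEnvelopingAlgebra.ι R x * u) ⊗ₜ m := rfl

/-- The vector `1 ⊗ m` together with its images under `b`. -/
def basePair : M →ₗ[R] Carrier a M × (b →ₗ[R] Carrier a M) :=
  LinearMap.prod (TensorProduct.mk R _ M 1)
    (((LinearMap.compRight R (TensorProduct.mk R (UniversalEnvelopingAlgebra R a) M 1) :
      (b →ₗ[R] M) →ₗ[R] (b →ₗ[R] Carrier a M))) ∘ₗ (ρ : b →ₗ[R] Module.End R M).flip)

/-- The action of the enveloping algebra of `a` on pairs. -/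
def pairAlgHom : UniversalEnvelopingAlgebra R a →ₐ[R]
    Module.End R (Carrier a M × (b →ₗ[R] Carrier a M)) :=
  UniversalEnvelopingAlgebra.lift R (s.pairRep (leftRep a M))

theorem pairAlgHom_ι_mul (x : a) (u : UniversalEnvelopingAlgebra R a)
    (p : Carrier a M × (b →ₗ[R] Carrier a M)) :
    s.pairAlgHom (UniversalEnvelopingAlgebra.ι R x * u) p =
      s.pairOp (leftRep a M) x (s.pairAlgHom u p) := by
  rw [map_mul, Module.End.mul_apply, pairAlgHom, UniversalEnvelopingAlgebra.lift_ι_apply]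
  rfl

/-- The first component remembers u ⊗ m itself, so the second component may be read as the map y ↦
y(u ⊗ m). In this way the action of b is defined by recursion on u without choosing a basis of U(a).
-/
theorem pairAlgHom_fst (u : UniversalEnvelopingAlgebra R a) (m : M) :
    (s.pairAlgHom u (basePair ρ m)).1 = u ⊗ₜ m := by
  let S : Submodule R (UniversalEnvelopingAlgebra R a) :=
    LinearMap.eqLocus
      (LinearMap.fst R _ _ ∘ₗ (s.pairAlgHom (M := M)).toLinearMap.flip (basePair ρ m))
      ((TensorProduct.mk R _ M).flip m)
  refine envelope_induction S ?_ (fun x v hv => ?_) u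
  · change (s.pairAlgHom 1 (basePair ρ m)).1 = 1 ⊗ₜ m
    rw [map_one]; rfl
  · change (s.pairAlgHom v (basePair ρ m)).1 = v ⊗ₜ m at hv
    change (s.pairAlgHom _ (basePair ρ m)).1 = _ ⊗ₜ m
    rw [pairAlgHom_ι_mul, pairOp_fst, hv, leftRep_tmul]

/-- The action of `b` on the induced module. -/
def rightOp : b →ₗ[R] Module.End R (Carrier a M) :=
  LinearMap.flip <| TensorProduct.lift <| LinearMap.mk₂ R
    (fun u m => (s.pairAlgHom u (basePair ρ m)).2)
    (by intro u u' m; simp) (by intro c u m; simp) (by intro u m m'; simp) (by intro c u m; simp)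

theorem rightOp_tmul (y : b) (u : UniversalEnvelopingAlgebra R a) (m : M) :
    s.rightOp ρ y (u ⊗ₜ m) = (s.pairAlgHom u (basePair ρ m)).2 y := rfl

theorem rightOp_one_tmul (y : b) (m : M) :
    s.rightOp ρ y ((1 : UniversalEnvelopingAlgebra R a) ⊗ₜ m) = 1 ⊗ₜ ρ y m := by
  rw [rightOp_tmul, map_one]; rfl

/-- This is y x = x y + [y, x] with the bracket split into its two components, the recursion built
into `pairOp`. -/
theorem rightOp_leftRep (y : b) (x : a) (w : Carrier a M) :
    s.rightOp ρ y (leftRep a M x w) = leftRep a M x (s.rightOp ρ y w) +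
      leftRep a M (s.fst ⁅(y : L), (x : L)⁆) w + s.rightOp ρ (s.snd ⁅(y : L), (x : L)⁆) w := by
  induction w using TensorProduct.induction_on with
  | zero => simp
  | add w w' h h' => simp only [map_add, h, h']; abel
  | tmul u m =>
    rw [leftRep_tmul, rightOp_tmul, pairAlgHom_ι_mul, pairOp_snd, pairAlgHom_fst]
    rfl

/-- The operators by which the whole Lie algebra acts on the induced module. -/
def inducedOp : L →ₗ[R] Module.End R (Carrier a M) :=
  (leftRep a M : a →ₗ[R] _) ∘ₗ s.fst + s.rightOp ρ ∘ₗ s.snd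

theorem inducedOp_apply (x : L) :
    s.inducedOp ρ x = leftRep a M (s.fst x) + s.rightOp ρ (s.snd x) := rfl

theorem inducedOp_of_left (x : a) : s.inducedOp ρ x = leftRep a M x := by
  rw [inducedOp_apply, s.fst_coe, s.snd_of_mem x.2, map_zero, add_zero]

theorem inducedOp_of_right (y : b) : s.inducedOp ρ y = s.rightOp ρ y := by
  rw [inducedOp_apply, s.snd_coe, s.fst_of_mem y.2, map_zero, zero_add]

theorem inducedOp_lie_left (z : L) (x : a) (w : Carrier a M) :
    s.inducedOp ρ z (s.inducedOp ρ x w) =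
      s.inducedOp ρ x (s.inducedOp ρ z w) + s.inducedOp ρ ⁅z, (x : L)⁆ w := by
  have h1 : ⁅z, (x : L)⁆ = ((⁅s.fst z, x⁆ : a) : L) + ⁅(s.snd z : L), (x : L)⁆ := by
    conv_lhs => rw [← s.fst_add_snd z, add_lie]
    rfl
  rw [h1, map_add, inducedOp_of_left, inducedOp_of_left, inducedOp_apply s ρ z, LieHom.map_lie,
    Ring.lie_def, inducedOp_apply s ρ ⁅(s.snd z : L), (x : L)⁆]
  simp only [LinearMap.add_apply, LinearMap.sub_apply, Module.End.mul_apply, rightOp_leftRep,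
    map_add]
  abel

theorem inducedOp_lie (z z' : L) (w : Carrier a M) :
    s.inducedOp ρ z (s.inducedOp ρ z' w) =
      s.inducedOp ρ z' (s.inducedOp ρ z w) + s.inducedOp ρ ⁅z, z'⁆ w := by
  have hleft := s.inducedOp_lie_left ρ
  -- Commutators with a are already settled, which leaves two elements of b. For w = u ⊗ m this is
  -- an induction on u: the case u = 1 holds because ρ is a representation, and the Jacobi identity
  -- carries the step.
  have key : ∀ y y' : b, s.inducedOp ρ (y : L) (s.inducedOp ρ (y' : L) w) =
      s.inducedOp ρ y' (s.inducedOp ρ y w) + s.inducedOp ρ ⁅(y : L), (y' : L)⁆ w := by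
    induction w using TensorProduct.induction_on with
    | zero => simp
    | add w w' h h' => intro y y'; rw [map_add, map_add, map_add, map_add, map_add, h, h']; abel
    | tmul u m =>
      let S : Submodule R (UniversalEnvelopingAlgebra R a) :=
        ⨅ y : b, ⨅ y' : b, LinearMap.eqLocus
          ((s.inducedOp ρ (y : L) ∘ₗ s.inducedOp ρ (y' : L)) ∘ₗ (TensorProduct.mk R _ M).flip m)
          ((s.inducedOp ρ (y' : L) ∘ₗ s.inducedOp ρ (y : L) + s.inducedOp ρ ⁅(y : L), (y' : L)⁆) ∘ₗ
            (TensorProduct.mk R _ M).flip m)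
      have hmem : ∀ u, u ∈ S ↔ ∀ y y' : b,
          s.inducedOp ρ (y : L) (s.inducedOp ρ (y' : L) (u ⊗ₜ m)) =
          s.inducedOp ρ y' (s.inducedOp ρ y (u ⊗ₜ m)) +
            s.inducedOp ρ ⁅(y : L), (y' : L)⁆ (u ⊗ₜ m) := by
        intro u
        simp only [S, Submodule.mem_iInf]
        rfl
      refine (hmem u).1 (envelope_induction S ((hmem 1).2 fun y y' => ?_) (fun x u hu => ?_) u)
      · have e1 : ⁅(y : L), (y' : L)⁆ = ((⁅y, y'⁆ : b) : L) := rfl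
        rw [e1]
        simp only [inducedOp_of_right, rightOp_one_tmul, LieHom.map_lie, Ring.lie_def,
          LinearMap.sub_apply, Module.End.mul_apply, TensorProduct.tmul_sub]
        abel
      · rw [hmem] at hu ⊢
        -- The brackets [y, x] with x in a need not lie in b, so the induction hypothesis is first
        -- extended to an arbitrary element in one of its two arguments.
        have hz : ∀ (z : L) (y' : b), s.inducedOp ρ z (s.inducedOp ρ (y' : L) (u ⊗ₜ m)) =
            s.inducedOp ρ y' (s.inducedOp ρ z (u ⊗ₜ m)) +
            s.inducedOp ρ ⁅z, (y' : L)⁆ (u ⊗ₜ m) := by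
          intro z y'
          have h2 := hleft (y' : L) (s.fst z) (u ⊗ₜ m)
          have h3 := hu (s.snd z) y'
          have h4 : s.inducedOp ρ ⁅(y' : L), (s.fst z : L)⁆ = - s.inducedOp ρ ⁅(s.fst z : L), (y' : L)⁆ := by
            rw [← lie_skew, map_neg]
          rw [h4, LinearMap.neg_apply] at h2
          conv_lhs => rw [← s.fst_add_snd z]
          conv_rhs => rw [← s.fst_add_snd z]
          simp only [map_add, LinearMap.add_apply, add_lie]
          rw [h3, h2]
          abel
        have hz' : ∀ (y : b) (z : L), s.inducedOp ρ (y : L) (s.inducedOp ρ z (u ⊗ₜ m)) =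
            s.inducedOp ρ z (s.inducedOp ρ y (u ⊗ₜ m)) +
            s.inducedOp ρ ⁅(y : L), z⁆ (u ⊗ₜ m) := by
          intro y z
          rw [hz z y, ← lie_skew (y : L) z, map_neg, LinearMap.neg_apply]
          abel
        intro y y'
        have e : (UniversalEnvelopingAlgebra.ι R x * u) ⊗ₜ m = s.inducedOp ρ x (u ⊗ₜ m) := by
          rw [inducedOp_of_left, leftRep_tmul]
        rw [e, hleft y' x, map_add, hleft y x, hu y y', hleft y x, map_add, map_add, hleft y' x,
          hleft ⁅(y : L), (y' : L)⁆ x, hz' y ⁅(y' : L), (x : L)⁆, hz ⁅(y : L), (x : L)⁆ y']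
        have e2 : ⁅(y : L), ⁅(y' : L), (x : L)⁆⁆ =
            ⁅⁅(y : L), (y' : L)⁆, (x : L)⁆ - ⁅⁅(y : L), (x : L)⁆, (y' : L)⁆ := by
          rw [leibniz_lie, ← lie_skew (y' : L) ⁅(y : L), (x : L)⁆]; abel
        rw [e2, map_sub, LinearMap.sub_apply]
        abel
  have hz := hleft z (s.fst z') w
  have h2 := hleft (s.snd z' : L) (s.fst z) w
  have h3 := key (s.snd z) (s.snd z')
  have h4 : s.inducedOp ρ ⁅(s.snd z' : L), (s.fst z : L)⁆ =
      - s.inducedOp ρ ⁅(s.fst z : L), (s.snd z' : L)⁆ := by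
    rw [← lie_skew, map_neg]
  have h5 : s.inducedOp ρ ⁅z, (s.snd z' : L)⁆ w =
      s.inducedOp ρ ⁅(s.fst z : L), (s.snd z' : L)⁆ w +
        s.inducedOp ρ ⁅(s.snd z : L), (s.snd z' : L)⁆ w := by
    conv_lhs => rw [← s.fst_add_snd z, add_lie, map_add]
    rfl
  rw [h4, LinearMap.neg_apply] at h2
  have h6 : s.inducedOp ρ z (s.inducedOp ρ (s.snd z' : L) w) =
      s.inducedOp ρ (s.snd z' : L) (s.inducedOp ρ z w) + s.inducedOp ρ ⁅z, (s.snd z' : L)⁆ w := by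
    rw [h5]
    have e : ∀ v, s.inducedOp ρ z v = s.inducedOp ρ (s.fst z : L) v + s.inducedOp ρ (s.snd z : L) v := by
      intro v
      conv_lhs => rw [← s.fst_add_snd z, map_add]
      rfl
    rw [e, e w, map_add, h3, h2]
    abel
  conv_lhs => rw [← s.fst_add_snd z']
  conv_rhs => rw [← s.fst_add_snd z']
  simp only [map_add, LinearMap.add_apply, lie_add]
  rw [hz, h6]
  abel

/-- The representation of the whole Lie algebra on the induced module. -/
def inducedRep : L →ₗ⁅R⁆ Module.End R (Carrier a M) where
  toLinearMap := s.inducedOp ρ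
  map_lie' {x y} := by
    refine LinearMap.ext fun w => ?_
    change s.inducedOp ρ ⁅x, y⁆ w = _
    rw [Ring.lie_def, LinearMap.sub_apply, Module.End.mul_apply, Module.End.mul_apply]
    change _ = s.inducedOp ρ x (s.inducedOp ρ y w) - s.inducedOp ρ y (s.inducedOp ρ x w)
    rw [s.inducedOp_lie ρ x y w]
    abel

/-- The projection of `U(a) ⊗ M` to `M` given by the augmentation of `U(a)`. -/
def augmentation (a : LieSubalgebra R L) (M : Type*) [AddCommGroup M] [Module R M] :
    Carrier a M →ₗ[R] M :=
  TensorProduct.lid R M ∘ₗ LinearMap.rTensor M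
    (UniversalEnvelopingAlgebra.lift R (0 : a →ₗ⁅R⁆ R)).toLinearMap

theorem augmentation_one_tmul (m : M) :
    augmentation a M ((1 : UniversalEnvelopingAlgebra R a) ⊗ₜ m) = m := by
  simp [augmentation]

theorem augmentation_leftRep (x : a) (w : Carrier a M) :
    augmentation a M (leftRep a M x w) = 0 := by
  induction w using TensorProduct.induction_on with
  | zero => simp
  | add w w' h h' => simp only [map_add, h, h', add_zero]
  | tmul u m =>
    rw [leftRep_tmul]
    simp only [augmentation, LinearMap.comp_apply, LinearMap.rTensor_tmul, AlgHom.toLinearMap_apply,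
      map_mul, UniversalEnvelopingAlgebra.lift_ι_apply]
    simp

end LieSplitting

end Splitting

/-! ### The triangular splitting of the affine algebra -/

namespace AffineSl2

theorem lie_mode (x y : Sl2) (m n : ℤ) : ⁅mode x m, mode y n⁆ =
    mode ⁅x, y⁆ (m + n) + (if m + n = 0 then (m : ℂ) * killing x y else 0) • K := by
  ext1
  · simp [lie_loop, add_loop, smul_loop, mode, K, loopBracket_single, -ite_smul]
  · simp [lie_central, add_central, smul_central, mode, K, loopCocycle_single, -ite_smul]
  · simp [lie_energy, add_energy, smul_energy, mode, K, -ite_smul]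

theorem lie_mode_of_ne (x y : Sl2) (m n : ℤ) (h : m = 0 ∨ m + n ≠ 0) :
    ⁅mode x m, mode y n⁆ = mode ⁅x, y⁆ (m + n) := by
  rw [lie_mode]
  rcases h with rfl | h
  · simp
  · simp [h]

theorem lie_L0_mode (x : Sl2) (n : ℤ) : ⁅L0, mode x n⁆ = (-(n : ℂ)) • mode x n := by
  ext1
  · simp [lie_loop, smul_loop, mode, L0, loopDeriv_single, -neg_smul]
  · simp [lie_central, smul_central, mode, L0, -neg_smul]
  · simp [lie_energy, smul_energy, mode, -neg_smul]

theorem lie_K (x : AffineSl2) : ⁅K, x⁆ = 0 := by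
  ext1
  · simp [lie_loop, K, zero_loop]
  · simp [lie_central, K, zero_central]
  · simp [lie_energy, zero_energy]

theorem mode_add (x y : Sl2) (n : ℤ) : mode (x + y) n = mode x n + mode y n := by
  ext1 <;> simp [mode, add_loop, add_central, add_energy]

theorem mode_smul (c : ℂ) (x : Sl2) (n : ℤ) : mode (c • x) n = c • mode x n := by
  ext1 <;> simp [mode, smul_loop, smul_central, smul_energy]

/-- The inclusion of the loop algebra. -/
def ofLoop : (ℤ →₀ Sl2) →ₗ[ℂ] AffineSl2 where
  toFun x := ⟨x, 0, 0⟩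
  map_add' x y := by ext1 <;> simp [add_loop, add_central, add_energy]
  map_smul' c x := by ext1 <;> simp [smul_loop, smul_central, smul_energy]

theorem eq_ofLoop (x : AffineSl2) : x = ofLoop x.loop + x.central • K + x.energy • L0 := by
  ext1 <;> simp [ofLoop, K, L0, add_loop, add_central, add_energy, smul_loop, smul_central,
    smul_energy]

end AffineSl2

open AffineSl2

/-- The basis `f`, `h`, `e` of `sl(2)`. -/
def gen : Fin 3 → Sl2 := ![Sl2.f, Sl2.h, Sl2.e]

/-- The weights of the basis, in units of the simple root. -/
def genWt : Fin 3 → ℤ := ![-1, 0, 1]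

theorem lie_h_gen (i : Fin 3) : ⁅Sl2.h, gen i⁆ = ((genWt i : ℂ) * 2) • gen i := by
  fin_cases i
  · simp [gen, genWt, Sl2.lie_h_f]
  · simp [gen, genWt]
  · simp [gen, genWt, Sl2.lie_h_e]

theorem sl2_eq (x : Sl2) : x = x.1 1 0 • gen 0 + x.1 0 0 • gen 1 + x.1 0 1 • gen 2 := by
  have h := Sl2.trace_eq x
  have h1 : ∀ y z : Sl2, (y + z).1 = y.1 + z.1 := fun _ _ => rfl
  have h2 : ∀ (c : ℂ) (z : Sl2), (c • z).1 = c • z.1 := fun _ _ => rfl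
  apply Subtype.ext
  rw [h1, h1, h2, h2, h2]
  ext i j
  fin_cases i <;> fin_cases j <;> simp [gen, Sl2.e, Sl2.h, Sl2.f, h]

/-- A subspace containing the modes of the basis elements of index `n` contains all modes of
index `n`. -/
theorem mode_mem (S : Submodule ℂ AffineSl2) (n : ℤ) (h : ∀ i, mode (gen i) n ∈ S) (x : Sl2) :
    mode x n ∈ S := by
  rw [sl2_eq x, mode_add, mode_add, mode_smul, mode_smul, mode_smul]
  exact S.add_mem (S.add_mem (S.smul_mem _ (h 0)) (S.smul_mem _ (h 1))) (S.smul_mem _ (h 2))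

theorem ofLoop_mem (S : Submodule ℂ AffineSl2) (x : ℤ →₀ Sl2)
    (h : ∀ n, x n ≠ 0 → ∀ i, mode (gen i) n ∈ S) : ofLoop x ∈ S := by
  rw [← Finsupp.sum_single x, Finsupp.sum, map_sum]
  exact S.sum_mem fun n hn => mode_mem S n (h n (Finsupp.mem_support_iff.1 hn)) _

/-- A subspace of the affine algebra containing `K`, `L₀` and the modes of the basis elements is
everything. -/
theorem affine_mem (S : Submodule ℂ AffineSl2) (hK : K ∈ S) (hL : L0 ∈ S)
    (h : ∀ i n, mode (gen i) n ∈ S) (x : AffineSl2) : x ∈ S := by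
  rw [eq_ofLoop x]
  exact S.add_mem (S.add_mem (ofLoop_mem S _ fun n _ i => h i n) (S.smul_mem _ hK))
    (S.smul_mem _ hL)

theorem loopBracket_apply_of_neg (x y : ℤ →₀ Sl2) (hx : ∀ n, 0 ≤ n → x n = 0)
    (hy : ∀ n, 0 ≤ n → y n = 0) (n : ℤ) (hn : 0 ≤ n) : loopBracket x y n = 0 := by
  change (x.sum fun m u => y.sum fun p v => Finsupp.single (m + p) ⁅u, v⁆) n = _
  rw [Finsupp.sum_apply]
  refine Finset.sum_eq_zero fun m _ => ?_
  change (y.sum fun p v => Finsupp.single (m + p) ⁅x m, v⁆) n = 0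
  rw [Finsupp.sum_apply]
  refine Finset.sum_eq_zero fun p _ => ?_
  by_cases hm : 0 ≤ m
  · simp [hx m hm]
  by_cases hp : 0 ≤ p
  · simp [hy p hp]
  exact Finsupp.single_eq_of_ne (by omega)

theorem loopCocycle_eq_zero_of_neg (x y : ℤ →₀ Sl2) (hx : ∀ n, 0 ≤ n → x n = 0)
    (hy : ∀ n, 0 ≤ n → y n = 0) : loopCocycle x y = 0 := by
  change (x.sum fun m u => (m : ℂ) * killing u (y (-m))) = 0
  refine Finset.sum_eq_zero fun m _ => ?_
  by_cases h : 0 ≤ m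
  · simp [hx m h]
  · simp [hy (-m) (by omega)]

/-- The subalgebra spanned by the modes `xₙ` with `n < 0`. -/
def affineLt : LieSubalgebra ℂ AffineSl2 where
  carrier := {x | (∀ n, 0 ≤ n → x.loop n = 0) ∧ x.central = 0 ∧ x.energy = 0}
  zero_mem' := ⟨fun _ _ => rfl, rfl, rfl⟩
  add_mem' := by
    rintro x y ⟨hx, hx1, hx2⟩ ⟨hy, hy1, hy2⟩
    refine ⟨fun n hn => ?_, ?_, ?_⟩
    · rw [add_loop, Finsupp.add_apply, hx n hn, hy n hn, add_zero]
    · rw [add_central, hx1, hy1, add_zero]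
    · rw [add_energy, hx2, hy2, add_zero]
  smul_mem' := by
    rintro c x ⟨hx, hx1, hx2⟩
    refine ⟨fun n hn => ?_, ?_, ?_⟩
    · rw [smul_loop, Finsupp.smul_apply, hx n hn, smul_zero]
    · rw [smul_central, hx1, mul_zero]
    · rw [smul_energy, hx2, mul_zero]
  lie_mem' := by
    rintro x y ⟨hx, hx1, hx2⟩ ⟨hy, hy1, hy2⟩
    refine ⟨fun n hn => ?_, ?_, rfl⟩
    · rw [lie_loop, hx2, hy2, zero_smul, zero_smul, add_zero, sub_zero,
        loopBracket_apply_of_neg _ _ hx hy n hn]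
    · rw [lie_central, loopCocycle_eq_zero_of_neg _ _ hx hy]

theorem mode_mem_affineLt (x : Sl2) {n : ℤ} (hn : n < 0) : mode x n ∈ affineLt :=
  ⟨fun p hp => Finsupp.single_eq_of_ne (by omega), rfl, rfl⟩

theorem mode_mem_affineGe (x : Sl2) {n : ℤ} (hn : 0 ≤ n) : mode x n ∈ affineGe :=
  fun p hp => Finsupp.single_eq_of_ne (by omega)

theorem K_mem_affineGe : K ∈ affineGe := fun _ _ => rfl

theorem L0_mem_affineGe : L0 ∈ affineGe := fun _ _ => rfl

/-- The affine algebra is the direct sum of the negative modes and of the non-negative part. -/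
def affineSplitting : LieSplitting affineLt affineGe where
  fst :=
    { toFun := fun x => ⟨⟨x.loop.filter (· < 0), 0, 0⟩,
        fun n hn => Finsupp.filter_apply_neg _ _ (not_lt.2 hn), rfl, rfl⟩
      map_add' := fun x y => Subtype.ext (AffineSl2.ext Finsupp.filter_add
        (add_zero 0).symm (add_zero 0).symm)
      map_smul' := fun c x => Subtype.ext (AffineSl2.ext Finsupp.filter_smul
        (mul_zero c).symm (mul_zero c).symm) }
  snd :=
    { toFun := fun x => ⟨⟨x.loop.filter (fun n => ¬ n < 0), x.central, x.energy⟩,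
        fun n hn => Finsupp.filter_apply_neg _ _ (not_not.2 hn)⟩
      map_add' := fun x y => Subtype.ext (AffineSl2.ext Finsupp.filter_add rfl rfl)
      map_smul' := fun c x => Subtype.ext (AffineSl2.ext Finsupp.filter_smul rfl rfl) }
  fst_add_snd x := AffineSl2.ext (Finsupp.filter_add_filter_not _ _) (zero_add _) (zero_add _)
  fst_coe x := Subtype.ext (AffineSl2.ext ((Finsupp.filter_eq_self_iff _ _).2 fun n hn => by
    by_contra h
    exact hn (x.2.1 n (not_lt.1 h))) x.2.2.1.symm x.2.2.2.symm)
  snd_coe x := Subtype.ext (AffineSl2.ext ((Finsupp.filter_eq_self_iff _ _).2 fun n hn h =>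
    hn (x.2 n h)) rfl rfl)

theorem toU_add (x y : AffineSl2) : toU (x + y) = toU x + toU y := LinearMap.map_add _ x y

theorem toU_smul (c : ℂ) (x : AffineSl2) : toU (c • x) = c • toU x := LinearMap.map_smul _ c x

theorem toU_zero : toU 0 = 0 := LinearMap.map_zero _

theorem toU_mul_toU (x y : AffineSl2) : toU x * toU y = toU y * toU x + toU ⁅x, y⁆ := by
  have h : toU ⁅x, y⁆ = toU x * toU y - toU y * toU x := by
    rw [toU, LieHom.map_lie]; rfl
  rw [h]; abel

/-! ### The ground projection of a relaxed Verma module and its spanning set of words -/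

section RelaxedVerma

variable {M : Type} [AddCommGroup M] [Module ℂ M] (k Δ : ℂ) (ρ : Sl2 →ₗ⁅ℂ⁆ Module.End ℂ M)

theorem mk_tmul (u : UAff) (m : M) :
    (Submodule.Quotient.mk (u ⊗ₜ m) : RelaxedVerma k Δ ρ) = u • groundMap k Δ ρ m := by
  change _ = Submodule.Quotient.mk (u • ((1 : UAff) ⊗ₜ[ℂ] m))
  rw [TensorProduct.smul_tmul', smul_eq_mul, mul_one]

theorem toU_smul_groundMap (x : affineGe) (m : M) :
    toU x.1 • groundMap k Δ ρ m = groundMap k Δ ρ (inflate k Δ ρ x m) := by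
  rw [← mk_tmul]
  refine (Submodule.Quotient.eq _).2 (Submodule.subset_span ⟨1, x, m, ?_⟩)
  rw [one_mul]; rfl

theorem K_smul_groundMap (m : M) :
    toU K • groundMap k Δ ρ m = k • groundMap k Δ ρ m := by
  rw [toU_smul_groundMap k Δ ρ ⟨K, K_mem_affineGe⟩, ← map_smul]
  congr 1
  simp [inflate, K]

theorem L0_smul_groundMap (m : M) :
    toU L0 • groundMap k Δ ρ m = Δ • groundMap k Δ ρ m := by
  rw [toU_smul_groundMap k Δ ρ ⟨L0, L0_mem_affineGe⟩, ← map_smul]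
  congr 1
  simp [inflate, L0]

theorem mode_zero_smul_groundMap (x : Sl2) (m : M) :
    toU (mode x 0) • groundMap k Δ ρ m = groundMap k Δ ρ (ρ x m) := by
  rw [toU_smul_groundMap k Δ ρ ⟨mode x 0, mode_mem_affineGe x le_rfl⟩]
  congr 1
  simp [inflate, mode]

/-- The action of the enveloping algebra on the model `U(affineLt) ⊗ M` of the relaxed Verma
module. -/
def modelHom : UAff →ₐ[ℂ] Module.End ℂ (LieSplitting.Carrier affineLt M) :=
  UniversalEnvelopingAlgebra.lift ℂ (affineSplitting.inducedRep (inflate k Δ ρ))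

theorem modelHom_toU (x : AffineSl2) :
    modelHom k Δ ρ (toU x) = affineSplitting.inducedOp (inflate k Δ ρ) x :=
  UniversalEnvelopingAlgebra.lift_ι_apply ℂ _ x

/-- The map `u ⊗ m ↦ u (1 ⊗ m)` to the model. -/
def toModelAux : UAff ⊗[ℂ] M →ₗ[ℂ] LieSplitting.Carrier affineLt M :=
  TensorProduct.lift (((modelHom k Δ ρ).toLinearMap.flip ∘ₗ
    TensorProduct.mk ℂ (UniversalEnvelopingAlgebra ℂ affineLt) M 1).flip)

theorem toModelAux_tmul (u : UAff) (m : M) :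
    toModelAux k Δ ρ (u ⊗ₜ m) = modelHom k Δ ρ u (1 ⊗ₜ m) := rfl

theorem toModelAux_smul (u : UAff) (z : UAff ⊗[ℂ] M) :
    toModelAux k Δ ρ (u • z) = modelHom k Δ ρ u (toModelAux k Δ ρ z) := by
  induction z using TensorProduct.induction_on with
  | zero => simp
  | add z z' h h' => rw [smul_add, map_add, h, h', map_add, map_add]
  | tmul u' m =>
    rw [TensorProduct.smul_tmul', smul_eq_mul, toModelAux_tmul, toModelAux_tmul, map_mul]
    rfl

theorem balancing_le : (balancing k Δ ρ).restrictScalars ℂ ≤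
    LinearMap.ker (toModelAux k Δ ρ) := by
  intro z hz
  rw [LinearMap.mem_ker]
  refine Submodule.span_induction ?_ (map_zero _) (fun x y _ _ hx hy => ?_)
    (fun u x _ hx => ?_) hz
  · rintro _ ⟨u, x, m, rfl⟩
    rw [map_sub, toModelAux_tmul, toModelAux_tmul, map_mul, Module.End.mul_apply, modelHom_toU,
      LieSplitting.inducedOp_of_right, LieSplitting.rightOp_one_tmul, sub_self]
  · rw [map_add, hx, hy, add_zero]
  · rw [toModelAux_smul, hx, map_zero]

/-- The map from a relaxed Verma module to its model. -/
def toModel : RelaxedVerma k Δ ρ →ₗ[ℂ] LieSplitting.Carrier affineLt M :=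
  ((balancing k Δ ρ).restrictScalars ℂ).liftQ (toModelAux k Δ ρ) (balancing_le k Δ ρ) ∘ₗ
    (Submodule.Quotient.restrictScalarsEquiv ℂ (balancing k Δ ρ)).symm.toLinearMap

theorem toModel_mk (z : UAff ⊗[ℂ] M) :
    toModel k Δ ρ (Submodule.Quotient.mk z) = toModelAux k Δ ρ z := rfl

theorem toModel_smul (u : UAff) (v : RelaxedVerma k Δ ρ) :
    toModel k Δ ρ (u • v) = modelHom k Δ ρ u (toModel k Δ ρ v) := by
  obtain ⟨z, rfl⟩ := Submodule.Quotient.mk_surjective _ v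
  rw [← Submodule.Quotient.mk_smul, toModel_mk, toModel_mk, toModelAux_smul]

/-- The projection of a relaxed Verma module onto the inducing module. -/
def groundProj : RelaxedVerma k Δ ρ →ₗ[ℂ] M :=
  LieSplitting.augmentation affineLt M ∘ₗ toModel k Δ ρ

/-- In particular the ground states form a faithful copy of M. -/
theorem groundProj_groundMap (m : M) : groundProj k Δ ρ (groundMap k Δ ρ m) = m := by
  have h : toModel k Δ ρ (groundMap k Δ ρ m) = 1 ⊗ₜ m := by
    change toModelAux k Δ ρ (1 ⊗ₜ m) = _
    rw [toModelAux_tmul, map_one]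
    rfl
  rw [groundProj, LinearMap.comp_apply, h, LieSplitting.augmentation_one_tmul]

theorem groundProj_toU_smul {x : AffineSl2} (hx : x ∈ affineLt) (v : RelaxedVerma k Δ ρ) :
    groundProj k Δ ρ (toU x • v) = 0 := by
  rw [groundProj, LinearMap.comp_apply, toModel_smul, modelHom_toU,
    affineSplitting.inducedOp_of_left (inflate k Δ ρ) ⟨x, hx⟩,
    LieSplitting.augmentation_leftRep]

/-- Words in the negative modes of the basis elements; `(i, n)` stands for the mode of index
`-(n + 1)` of the `i`-th basis element. -/
abbrev Word : Type := List (Fin 3 × ℕ)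

/-- The affine algebra element for a letter. -/
def letter (a : Fin 3 × ℕ) : AffineSl2 := mode (gen a.1) (-(a.2 + 1 : ℤ))

/-- The element of the enveloping algebra for a word. -/
def wordElt (w : Word) : UAff := (w.map fun a => toU (letter a)).prod

/-- The conformal weight of a word. -/
def wordDeg (w : Word) : ℕ := (w.map fun a => a.2 + 1).sum

/-- The `sl(2)`-weight of a word, in units of the simple root. -/
def wordWt (w : Word) : ℤ := (w.map fun a => genWt a.1).sum

theorem wordElt_nil : wordElt [] = 1 := rfl

theorem wordElt_cons (a : Fin 3 × ℕ) (w : Word) :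
    wordElt (a :: w) = toU (letter a) * wordElt w := by
  rw [wordElt, List.map_cons, List.prod_cons]; rfl

theorem wordDeg_cons (a : Fin 3 × ℕ) (w : Word) :
    wordDeg (a :: w) = a.2 + 1 + wordDeg w := by
  rw [wordDeg, List.map_cons, List.sum_cons]; rfl

theorem wordWt_cons (a : Fin 3 × ℕ) (w : Word) :
    wordWt (a :: w) = genWt a.1 + wordWt w := by
  rw [wordWt, List.map_cons, List.sum_cons]; rfl

theorem letter_mem (a : Fin 3 × ℕ) : letter a ∈ affineLt :=
  mode_mem_affineLt _ (by omega)

theorem affineLt_le (S : Submodule ℂ AffineSl2) (h : ∀ a, letter a ∈ S) {x : AffineSl2}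
    (hx : x ∈ affineLt) : x ∈ S := by
  have e : x = ofLoop x.loop := AffineSl2.ext rfl hx.2.1 hx.2.2
  rw [e]
  refine ofLoop_mem S _ fun n hn i => ?_
  have hn : n < 0 := by
    by_contra h1
    exact hn (hx.1 n (not_lt.1 h1))
  have := h (i, (-n - 1).toNat)
  rwa [letter, show (-(((-n - 1).toNat : ℕ) + 1 : ℤ)) = n by omega] at this

/-- A relaxed Verma module is spanned by the words in the negative modes applied to ground
states. -/
theorem relaxedVerma_induction (S : Submodule ℂ (RelaxedVerma k Δ ρ))
    (h : ∀ w m, wordElt w • groundMap k Δ ρ m ∈ S) (v : RelaxedVerma k Δ ρ) : v ∈ S := by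
  let T : Submodule ℂ (RelaxedVerma k Δ ρ) :=
    Submodule.span ℂ (Set.range fun p : Word × M => wordElt p.1 • groundMap k Δ ρ p.2)
  have hT : ∀ w m, wordElt w • groundMap k Δ ρ m ∈ T :=
    fun w m => Submodule.subset_span ⟨(w, m), rfl⟩
  let A : RelaxedVerma k Δ ρ → AffineSl2 →ₗ[ℂ] RelaxedVerma k Δ ρ := fun v =>
    { toFun := fun x => toU x • v
      map_add' := fun x y => by rw [toU_add, add_smul]
      map_smul' := fun c x => by rw [toU_smul, smul_assoc]; rfl }
  have hlt : ∀ x ∈ affineLt, ∀ v ∈ T, toU x • v ∈ T := by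
    intro x hx v hv
    refine affineLt_le (T.comap (A v)) (fun a => ?_) hx
    change toU (letter a) • v ∈ T
    refine Submodule.span_induction ?_ ?_ (fun x y _ _ hx hy => ?_) (fun c x _ hx => ?_) hv
    · rintro _ ⟨p, rfl⟩
      have := hT (a :: p.1) p.2
      rwa [wordElt_cons, mul_smul] at this
    · rw [smul_zero]; exact T.zero_mem
    · rw [smul_add]; exact T.add_mem hx hy
    · rw [smul_comm]; exact T.smul_mem _ hx
  -- A non-negative element is moved to the right through the word. The negative part of each
  -- commutator is handled by `hlt`, and its non-negative part acts on a shorter word.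
  have hge : ∀ (w : Word) (m : M), ∀ y ∈ affineGe, toU y • wordElt w • groundMap k Δ ρ m ∈ T := by
    intro w m
    induction w with
    | nil =>
      intro y hy
      rw [wordElt_nil, one_smul, toU_smul_groundMap k Δ ρ ⟨y, hy⟩]
      have := hT [] (inflate k Δ ρ ⟨y, hy⟩ m)
      rwa [wordElt_nil, one_smul] at this
    | cons a w ih =>
      intro y hy
      rw [wordElt_cons, ← mul_smul, ← mul_assoc, toU_mul_toU, add_mul, add_smul, mul_assoc,
        mul_smul, mul_smul]
      refine T.add_mem (hlt _ (letter_mem a) _ (ih y hy)) ?_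
      rw [← affineSplitting.fst_add_snd ⁅y, letter a⁆, toU_add, add_mul, add_smul, mul_smul,
        mul_smul]
      exact T.add_mem (hlt _ (affineSplitting.fst _).2 _ (hT w m)) (ih _ (affineSplitting.snd _).2)
  have hall : ∀ x : AffineSl2, ∀ v ∈ T, toU x • v ∈ T := by
    intro x v hv
    rw [← affineSplitting.fst_add_snd x, toU_add, add_smul]
    refine T.add_mem (hlt _ (affineSplitting.fst _).2 _ hv) ?_
    refine Submodule.span_induction ?_ ?_ (fun x y _ _ hx hy => ?_) (fun c x _ hx => ?_) hv
    · rintro _ ⟨p, rfl⟩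
      exact hge p.1 p.2 _ (affineSplitting.snd _).2
    · rw [smul_zero]; exact T.zero_mem
    · rw [smul_add]; exact T.add_mem hx hy
    · rw [smul_comm]; exact T.smul_mem _ hx
  have hTS : T ≤ S := Submodule.span_le.2 (by rintro _ ⟨p, rfl⟩; exact h p.1 p.2)
  apply hTS
  obtain ⟨z, rfl⟩ := Submodule.Quotient.mk_surjective _ v
  induction z using TensorProduct.induction_on with
  | zero => exact T.zero_mem
  | add z z' h h' => exact T.add_mem h h'
  | tmul u m =>
    rw [mk_tmul]
    refine envelope_smul_mem T hall u _ ?_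
    have := hT [] m
    rwa [wordElt_nil, one_smul] at this

/-- Two linear maps on a relaxed Verma module agree if they agree on words applied to ground
states. -/
theorem relaxedVerma_hom_ext {V : Type*} [AddCommGroup V] [Module ℂ V]
    {φ ψ : RelaxedVerma k Δ ρ →ₗ[ℂ] V}
    (h : ∀ w m, φ (wordElt w • groundMap k Δ ρ m) = ψ (wordElt w • groundMap k Δ ρ m)) :
    φ = ψ :=
  LinearMap.ext fun v => relaxedVerma_induction k Δ ρ (LinearMap.eqLocus φ ψ) h v

theorem groundProj_wordElt_cons (a : Fin 3 × ℕ) (w : Word) (v : RelaxedVerma k Δ ρ) :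
    groundProj k Δ ρ (wordElt (a :: w) • v) = 0 := by
  rw [wordElt_cons, mul_smul, groundProj_toU_smul k Δ ρ (letter_mem a)]

/-- The bracket of a zero mode with a negative mode is a negative mode, so zero modes preserve the
span of the nonempty words applied to ground states, which the projection kills. -/
theorem groundProj_mode_zero_smul (x : Sl2) (v : RelaxedVerma k Δ ρ) :
    groundProj k Δ ρ (toU (mode x 0) • v) = ρ x (groundProj k Δ ρ v) := by
  have h : groundProj k Δ ρ ∘ₗ act (RelaxedVerma k Δ ρ) (mode x 0) =
      ρ x ∘ₗ groundProj k Δ ρ := by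
    refine relaxedVerma_hom_ext k Δ ρ fun w m => ?_
    change groundProj k Δ ρ (toU (mode x 0) • _) = ρ x (groundProj k Δ ρ _)
    rcases w with _ | ⟨a, w⟩
    · rw [wordElt_nil, one_smul, mode_zero_smul_groundMap, groundProj_groundMap,
        groundProj_groundMap]
    · rw [groundProj_wordElt_cons, map_zero, wordElt_cons, ← mul_smul, ← mul_assoc, toU_mul_toU,
        add_mul, add_smul, map_add, mul_assoc, mul_smul, groundProj_toU_smul k Δ ρ (letter_mem a),
        zero_add, letter, lie_mode_of_ne _ _ _ _ (Or.inl rfl), mul_smul,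
        groundProj_toU_smul k Δ ρ (mode_mem_affineLt _ (by omega))]
  exact DFunLike.congr_fun h v

end RelaxedVerma

/-! ### The radical and the injectivity of f modulo it -/

section Radical

variable {M : Type} [AddCommGroup M] [Module ℂ M] (k Δ : ℂ) (ρ : Sl2 →ₗ⁅ℂ⁆ Module.End ℂ M)

theorem K_smul (v : RelaxedVerma k Δ ρ) : toU K • v = k • v := by
  refine DFunLike.congr_fun (relaxedVerma_hom_ext k Δ ρ
    (φ := act (RelaxedVerma k Δ ρ) K) (ψ := k • LinearMap.id) fun w m => ?_) v
  change toU K • wordElt w • groundMap k Δ ρ m = k • wordElt w • groundMap k Δ ρ m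
  induction w with
  | nil => rw [wordElt_nil, one_smul, K_smul_groundMap]
  | cons a w ih =>
    rw [wordElt_cons, ← mul_smul, ← mul_assoc, toU_mul_toU, lie_K, toU_zero, add_zero, mul_assoc,
      mul_smul, mul_smul, ih, smul_comm, mul_smul]

theorem L0_smul_word (w : Word) (m : M) : toU L0 • wordElt w • groundMap k Δ ρ m =
    (Δ + wordDeg w) • wordElt w • groundMap k Δ ρ m := by
  induction w with
  | nil => rw [wordElt_nil, one_smul, L0_smul_groundMap]; simp [wordDeg]
  | cons a w ih =>
    rw [wordElt_cons, ← mul_smul, ← mul_assoc, toU_mul_toU, letter, lie_L0_mode, toU_smul,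
      add_mul, add_smul, mul_assoc, mul_smul, mul_smul, ih, smul_comm, mul_smul, smul_assoc, ← add_smul, mul_smul, wordDeg_cons]
    push_cast
    congr 1
    ring

theorem h_smul_word (w : Word) {m : M} {μ : ℂ} (hm : ρ Sl2.h m = μ • m) :
    toU (mode Sl2.h 0) • wordElt w • groundMap k Δ ρ m =
    (μ + wordWt w * 2) • wordElt w • groundMap k Δ ρ m := by
  induction w with
  | nil => rw [wordElt_nil, one_smul, mode_zero_smul_groundMap, hm, map_smul]; simp [wordWt]
  | cons a w ih =>
    rw [wordElt_cons, ← mul_smul, ← mul_assoc, toU_mul_toU, letter,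
      lie_mode_of_ne _ _ _ _ (Or.inl rfl), zero_add, lie_h_gen, mode_smul, toU_smul,
      add_mul, add_smul, mul_assoc, mul_smul, mul_smul, ih, smul_comm, mul_smul, smul_assoc, ← add_smul, mul_smul, wordWt_cons]
    push_cast
    congr 1
    ring

/-- A polynomial in `L₀` that annihilates the conformal weights `Δ + 1, …, Δ + N`. -/
def levelProj (Δ : ℂ) : ℕ → UAff
  | 0 => 1
  | N + 1 => (1 - ((N : ℂ) + 1)⁻¹ • (toU L0 - Δ • (1 : UAff))) * levelProj Δ N

theorem levelProj_smul_groundMap (N : ℕ) (m : M) :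
    levelProj Δ N • groundMap k Δ ρ m = groundMap k Δ ρ m := by
  induction N with
  | zero => exact one_smul _ _
  | succ N ih =>
    rw [levelProj, mul_smul, ih, sub_smul, one_smul, smul_assoc, sub_smul, L0_smul_groundMap,
      smul_assoc Δ, one_smul, sub_self, smul_zero, sub_zero]

/-- The factor 1 - (L₀ - Δ)/(d + 1) is zero on conformal weight Δ + d + 1, and all the factors act
as scalars on a word. -/
theorem levelProj_smul_word (N : ℕ) (w : Word) (m : M) (h0 : 0 < wordDeg w)
    (hN : wordDeg w ≤ N) : levelProj Δ N • wordElt w • groundMap k Δ ρ m = 0 := by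
  have key : ∀ N : ℕ, ∃ c : ℂ, levelProj Δ N • wordElt w • groundMap k Δ ρ m =
      c • wordElt w • groundMap k Δ ρ m ∧ (wordDeg w ≤ N → c = 0) := by
    intro N
    induction N with
    | zero => exact ⟨1, by rw [levelProj, one_smul, one_smul], fun h => by omega⟩
    | succ N ih =>
      obtain ⟨c, hc, hc0⟩ := ih
      refine ⟨(1 - ((N : ℂ) + 1)⁻¹ * wordDeg w) * c, ?_, fun h => ?_⟩
      · rw [levelProj, mul_smul, hc, smul_comm, sub_smul, one_smul, smul_assoc, sub_smul,
          L0_smul_word, smul_assoc Δ, one_smul]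
        generalize wordElt w • groundMap k Δ ρ m = z
        module
      · rcases Nat.lt_or_ge N (wordDeg w) with h1 | h1
        · have h2 : wordDeg w = N + 1 := by omega
          have h3 : (N : ℂ) + 1 ≠ 0 := by exact_mod_cast N.succ_ne_zero
          rw [h2]
          push_cast
          rw [inv_mul_cancel₀ h3]
          simp
        · rw [hc0 h1, mul_zero]
  obtain ⟨c, hc, hc0⟩ := key N
  rw [hc, hc0 hN, zero_smul]

/-- The ground component of a vector is obtained from it by the action of the enveloping
algebra. -/
theorem exists_smul_eq_groundMap (v : RelaxedVerma k Δ ρ) :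
    ∃ u : UAff, u • v = groundMap k Δ ρ (groundProj k Δ ρ v) := by
  -- Different vectors need different N. Asking for all sufficiently large N makes the condition
  -- stable under addition.
  let S : Submodule ℂ (RelaxedVerma k Δ ρ) :=
    { carrier := {v | ∃ N₀, ∀ N, N₀ ≤ N →
        levelProj Δ N • v = groundMap k Δ ρ (groundProj k Δ ρ v)}
      zero_mem' := ⟨0, fun N _ => by rw [smul_zero, map_zero, map_zero]⟩
      add_mem' := by
        rintro x y ⟨N₁, h₁⟩ ⟨N₂, h₂⟩
        refine ⟨max N₁ N₂, fun N hN => ?_⟩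
        rw [smul_add, h₁ N (le_of_max_le_left hN), h₂ N (le_of_max_le_right hN), map_add, map_add]
      smul_mem' := by
        rintro c x ⟨N₁, h₁⟩
        refine ⟨N₁, fun N hN => ?_⟩
        rw [smul_comm, h₁ N hN, map_smul, map_smul] }
  have hv : v ∈ S := by
    refine relaxedVerma_induction k Δ ρ S (fun w m => ⟨wordDeg w, fun N hN => ?_⟩) v
    rcases w with _ | ⟨a, w⟩
    · rw [wordElt_nil, one_smul, groundProj_groundMap, levelProj_smul_groundMap]
    · rw [groundProj_wordElt_cons, map_zero, levelProj_smul_word _ _ _ _ _ _ ?_ hN]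
      rw [wordDeg_cons]; omega
  obtain ⟨N, hN⟩ := hv
  exact ⟨_, hN N le_rfl⟩

/-- The vectors that generate a submodule without ground component. -/
def radical : Submodule UAff (RelaxedVerma k Δ ρ) where
  carrier := {v | ∀ u : UAff, groundProj k Δ ρ (u • v) = 0}
  zero_mem' u := by rw [smul_zero, map_zero]
  add_mem' hx hy u := by rw [smul_add, map_add, hx u, hy u, add_zero]
  smul_mem' c x hx u := by rw [← mul_smul]; exact hx _

theorem radical_inf_groundStates :
    (radical k Δ ρ).restrictScalars ℂ ⊓ groundStates k Δ ρ = ⊥ := by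
  rw [eq_bot_iff]
  rintro _ ⟨h, ⟨m, rfl⟩⟩
  have h1 : groundProj k Δ ρ ((1 : UAff) • groundMap k Δ ρ m) = 0 := h 1
  rw [one_smul, groundProj_groundMap] at h1
  rw [h1, map_zero]
  exact Submodule.zero_mem _

/-- The ground component of any descendant of a vector of `N` is again a descendant, so it lies in
`N` and among the ground states, and hence vanishes. -/
theorem le_radical {N : Submodule UAff (RelaxedVerma k Δ ρ)}
    (hN : N.restrictScalars ℂ ⊓ groundStates k Δ ρ = ⊥) : N ≤ radical k Δ ρ := by
  intro v hv u
  obtain ⟨u', hu'⟩ := exists_smul_eq_groundMap k Δ ρ (u • v)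
  have h1 : groundMap k Δ ρ (groundProj k Δ ρ (u • v)) ∈
      N.restrictScalars ℂ ⊓ groundStates k Δ ρ :=
    ⟨by rw [← hu']; exact N.smul_mem _ (N.smul_mem _ hv), ⟨_, rfl⟩⟩
  rw [hN, Submodule.mem_bot] at h1
  rw [← groundProj_groundMap k Δ ρ (groundProj k Δ ρ (u • v)), h1, map_zero]

theorem nonGroundSum_eq_radical : nonGroundSum k Δ ρ = radical k Δ ρ :=
  le_antisymm (sSup_le fun _ hN => le_radical k Δ ρ hN)
    (le_sSup (radical_inf_groundStates k Δ ρ))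

/-- The inner derivation of the enveloping algebra defined by the zero mode of `f`. -/
def adF : Module.End ℂ UAff :=
  LinearMap.mulLeft ℂ (toU (mode Sl2.f 0)) - LinearMap.mulRight ℂ (toU (mode Sl2.f 0))

theorem adF_apply (u : UAff) : adF u = toU (mode Sl2.f 0) * u - u * toU (mode Sl2.f 0) := rfl

theorem adF_mul (u v : UAff) : adF (u * v) = adF u * v + u * adF v := by
  simp only [adF_apply]
  noncomm_ring

theorem adF_toU (x : AffineSl2) : adF (toU x) = toU ⁅mode Sl2.f 0, x⁆ := by
  rw [adF_apply, toU_mul_toU]; abel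

/-- By the Leibniz rule each application of `adF` lowers i or j by one. When either exponent reaches
0, the corresponding factor is itself zero. -/
theorem adF_pow_mul (n : ℕ) : ∀ (i j : ℕ) (u v : UAff), i + j = n → (adF ^ i) u = 0 →
    (adF ^ j) v = 0 → (adF ^ n) (u * v) = 0 := by
  induction n with
  | zero =>
    rintro i j u v h hu hv
    obtain rfl : i = 0 := by omega
    have hu : u = 0 := hu
    rw [hu, zero_mul, map_zero]
  | succ n ih =>
    rintro i j u v h hu hv
    rcases i with _ | i
    · have hu : u = 0 := hu
      rw [hu, zero_mul, map_zero]
    rcases j with _ | j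
    · have hv : v = 0 := hv
      rw [hv, mul_zero, map_zero]
    rw [pow_succ, Module.End.mul_apply, adF_mul, map_add,
      ih i (j + 1) (adF u) v (by omega) (by rwa [pow_succ] at hu) hv,
      ih (i + 1) j u (adF v) (by omega) hu (by rwa [pow_succ] at hv), add_zero]

/-- The elements of the enveloping algebra on which the zero mode of `f` acts nilpotently. -/
def adFNilpotent : Submodule ℂ UAff where
  carrier := {u | ∃ j, (adF ^ j) u = 0}
  zero_mem' := ⟨0, map_zero _⟩
  add_mem' := by
    rintro x y ⟨i, hi⟩ ⟨j, hj⟩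
    refine ⟨i + j, ?_⟩
    have hi' : (adF ^ (i + j)) x = 0 := by
      rw [add_comm, pow_add, Module.End.mul_apply, hi, map_zero]
    have hj' : (adF ^ (i + j)) y = 0 := by rw [pow_add, Module.End.mul_apply, hj, map_zero]
    rw [map_add, hi', hj', add_zero]
  smul_mem' := by
    rintro c x ⟨i, hi⟩
    exact ⟨i, by rw [map_smul, hi, smul_zero]⟩

theorem mem_adFNilpotent_of_adF {u : UAff} (h : adF u ∈ adFNilpotent) : u ∈ adFNilpotent := by
  obtain ⟨j, hj⟩ := h
  exact ⟨j + 1, by rwa [pow_succ]⟩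

/-- Up to scalars the bracket with f₀ sends eₙ to hₙ, hₙ to fₙ and fₙ to 0, and it kills K and L₀.
The Leibniz rule extends nilpotency to products. -/
theorem mem_adFNilpotent (u : UAff) : u ∈ adFNilpotent := by
  have h0 : ∀ u, adF u = 0 → u ∈ adFNilpotent := fun u hu => ⟨1, by rwa [pow_one]⟩
  have hf : ∀ n, toU (mode (gen 0) n) ∈ adFNilpotent := by
    intro n
    refine h0 _ ?_
    have h1 : ⁅Sl2.f, gen 0⁆ = 0 := lie_self Sl2.f
    rw [adF_toU, lie_mode_of_ne _ _ _ _ (Or.inl rfl), h1, ← zero_smul ℂ Sl2.f, mode_smul,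
      zero_smul, toU_zero]
  have hh : ∀ n, toU (mode (gen 1) n) ∈ adFNilpotent := by
    intro n
    refine mem_adFNilpotent_of_adF ?_
    have h1 : ⁅Sl2.f, gen 1⁆ = (2 : ℂ) • gen 0 := by
      change ⁅Sl2.f, Sl2.h⁆ = (2 : ℂ) • Sl2.f
      rw [← lie_skew, Sl2.lie_h_f, neg_smul, neg_neg]
    rw [adF_toU, lie_mode_of_ne _ _ _ _ (Or.inl rfl), h1, mode_smul, toU_smul, zero_add]
    exact Submodule.smul_mem _ _ (hf n)
  have he : ∀ n, toU (mode (gen 2) n) ∈ adFNilpotent := by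
    intro n
    refine mem_adFNilpotent_of_adF ?_
    have h1 : ⁅Sl2.f, gen 2⁆ = (-1 : ℂ) • gen 1 := by
      change ⁅Sl2.f, Sl2.e⁆ = (-1 : ℂ) • Sl2.h
      rw [← lie_skew, Sl2.lie_e_f, neg_smul, one_smul]
    rw [adF_toU, lie_mode_of_ne _ _ _ _ (Or.inl rfl), h1, mode_smul, toU_smul, zero_add]
    exact Submodule.smul_mem _ _ (hh n)
  have hx : ∀ x, toU x ∈ adFNilpotent := by
    intro x
    refine affine_mem (adFNilpotent.comap
      (UniversalEnvelopingAlgebra.ι ℂ : AffineSl2 →ₗ⁅ℂ⁆ UAff).toLinearMap) ?_ ?_ ?_ x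
    · refine h0 _ ?_
      change adF (toU K) = 0
      rw [adF_toU, ← lie_skew, lie_K, neg_zero, toU_zero]
    · refine h0 _ ?_
      change adF (toU L0) = 0
      rw [adF_toU, ← lie_skew, lie_L0_mode]
      simp
    · intro i n
      fin_cases i
      exacts [hf n, hh n, he n]
  refine envelope_induction adFNilpotent (h0 _ (by simp [adF_apply])) (fun x v hv => ?_) u
  obtain ⟨i, hi⟩ := hx x
  obtain ⟨j, hj⟩ := hv
  exact ⟨i + j, adF_pow_mul _ i j _ _ rfl hi hj⟩

/-- If `f` acts injectively on the inducing module, then it acts injectively on the quotient of the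
relaxed Verma module by its radical. -/
theorem mem_radical_of_f_smul (hρ : Function.Injective (ρ Sl2.f)) {v : RelaxedVerma k Δ ρ}
    (hv : toU (mode Sl2.f 0) • v ∈ radical k Δ ρ) : v ∈ radical k Δ ρ := by
  -- With P the ground projection, f P(uv) = P([f, u]v) + P(u f v). The first term vanishes by
  -- induction on the order of nilpotency and the second because f v is in the radical; injectivity
  -- of f on M then gives P(uv) = 0.
  have key : ∀ (j : ℕ) (u : UAff), (adF ^ j) u = 0 → groundProj k Δ ρ (u • v) = 0 := by
    intro j
    induction j with
    | zero =>
      intro u hu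
      have hu : u = 0 := hu
      rw [hu, zero_smul, map_zero]
    | succ j ih =>
      intro u hu
      have h1 := ih (adF u) (by rwa [pow_succ] at hu)
      rw [adF_apply, sub_smul, mul_smul, mul_smul, map_sub, hv u, sub_zero,
        groundProj_mode_zero_smul] at h1
      exact hρ (by rw [h1, map_zero])
  intro u
  obtain ⟨j, hj⟩ := mem_adFNilpotent u
  exact key j u hj

end Radical

/-! ### Independence of weight spaces and spanning families of weight vectors -/

section WeightSpaces

/-- By the modular law A i = B i ⊔ (A i ⊓ ⨆ A j over j ≠ i), and independence removes the second
term. It is used to show that the obvious vectors fill a weight space. -/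
theorem _root_.iSupIndep.eq_of_le_of_iSup_eq_top {α ι : Type*} [CompleteLattice α]
    [IsModularLattice α] {A B : ι → α} (hA : iSupIndep A) (hBA : ∀ i, B i ≤ A i)
    (hB : ⨆ i, B i = ⊤) (i : ι) : A i = B i := by
  have h1 : ⊤ ≤ B i ⊔ ⨆ j, ⨆ _ : j ≠ i, A j := by
    rw [← hB]
    refine iSup_le fun j => ?_
    by_cases h : j = i
    · subst h; exact le_sup_left
    · exact (hBA j).trans (le_sup_of_le_right (le_iSup₂_of_le j h le_rfl))
  have h2 : A i = (B i ⊔ ⨆ j, ⨆ _ : j ≠ i, A j) ⊓ A i := by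
    rw [top_le_iff.1 h1, top_inf_eq]
  rw [h2, sup_inf_assoc_of_le _ (hBA i), inf_comm, (hA i).eq_bot, sup_bot_eq]

variable (V : Type) [AddCommGroup V] [Module UAff V] [Module ℂ V] [IsScalarTower ℂ UAff V]

theorem act_commute {x y : AffineSl2} (h : ⁅x, y⁆ = 0) : Commute (act V x) (act V y) := by
  refine LinearMap.ext fun v => ?_
  change toU x • toU y • v = toU y • toU x • v
  rw [← mul_smul, toU_mul_toU, h, toU_zero, add_zero, mul_smul]

theorem iSupIndep_weightSpace : iSupIndep fun p : ℂ × ℂ => weightSpace V p.1 p.2 := by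
  let op : Bool → Module.End ℂ V := fun i => bif i then act V (mode Sl2.h 0) else act V L0
  have hL : ⁅L0, mode Sl2.h 0⁆ = 0 := by rw [lie_L0_mode]; simp
  have hcomm : ∀ i j, Commute (op i) (op j) := by
    rintro (_ | _) (_ | _)
    · exact Commute.refl _
    · exact act_commute V hL
    · exact (act_commute V hL).symm
    · exact Commute.refl _
  -- Simultaneous generalised eigenspaces of commuting operators are independent. A weight space
  -- lies in the one indexed by its pair of eigenvalues, read as a function on `Bool`.
  have h1 := Module.End.independent_iInf_maxGenEigenspace_of_forall_mapsTo op
    (fun i j φ => Module.End.mapsTo_maxGenEigenspace_of_comm (hcomm j i) φ)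
  have h2 := h1.comp (f := fun (p : ℂ × ℂ) (i : Bool) => bif i then p.1 else p.2)
    (fun p p' h => Prod.ext (congr_fun h true) (congr_fun h false))
  refine h2.mono fun p => le_iInf fun i => ?_
  rcases i with _ | _
  · exact inf_le_right
  · exact inf_le_left.trans (Module.End.eigenspace_le_maxGenEigenspace)

variable {J : Type*} (s : J → V) (a c : J → ℂ)
  (ha : ∀ j, toU (mode Sl2.h 0) • s j = a j • s j) (hc : ∀ j, toU L0 • s j = c j • s j)

include ha hc in
theorem mem_weightSpace_of_smul (j : J) : s j ∈ weightSpace V (a j) (c j) :=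
  ⟨Module.End.mem_eigenspace_iff.2 (ha j),
    Module.End.eigenspace_le_maxGenEigenspace (Module.End.mem_eigenspace_iff.2 (hc j))⟩

include ha hc in
theorem iSup_weightSpace_of_span (hs : Submodule.span ℂ (Set.range s) = ⊤) :
    ⨆ μ : ℂ, ⨆ n : ℂ, weightSpace V μ n = ⊤ := by
  rw [← top_le_iff, ← hs, Submodule.span_le]
  rintro _ ⟨j, rfl⟩
  exact (le_iSup₂_of_le (f := fun μ n => weightSpace V μ n) (a j) (c j) le_rfl)
    (mem_weightSpace_of_smul V s a c ha hc j)

include ha hc in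
/-- A weight space is spanned by the members of a spanning family of weight vectors that it
contains. -/
theorem weightSpace_eq_span (hs : Submodule.span ℂ (Set.range s) = ⊤) (μ n : ℂ) :
    weightSpace V μ n = Submodule.span ℂ (s '' {j | a j = μ ∧ c j = n}) := by
  refine (iSupIndep_weightSpace V).eq_of_le_of_iSup_eq_top
    (B := fun p : ℂ × ℂ => Submodule.span ℂ (s '' {j | a j = p.1 ∧ c j = p.2})) ?_ ?_ (μ, n)
  · rintro ⟨μ, n⟩
    rw [Submodule.span_le]
    rintro _ ⟨j, ⟨rfl, rfl⟩, rfl⟩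
    exact mem_weightSpace_of_smul V s a c ha hc j
  · rw [← top_le_iff, ← hs, Submodule.span_le]
    rintro _ ⟨j, rfl⟩
    exact (le_iSup (fun p : ℂ × ℂ => Submodule.span ℂ (s '' {j | a j = p.1 ∧ c j = p.2}))
      (a j, c j)) (Submodule.subset_span ⟨j, ⟨rfl, rfl⟩, rfl⟩)

end WeightSpaces

/-- Every letter has positive degree, so removing the first letter gives a word of smaller degree.
The empty word is included for every n, since only a finite superset is needed. -/
theorem finite_wordDeg (n : ℕ) : {w : Word | wordDeg w = n}.Finite := by
  induction n using Nat.strong_induction_on with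
  | _ n ih =>
    have h1 : ({[]} ∪ ⋃ i : Fin 3, ⋃ m ∈ Set.Iio n,
        (fun w : Word => (i, m) :: w) '' {w : Word | wordDeg w = n - (m + 1)}).Finite := by
      refine (Set.finite_singleton _).union (Set.finite_iUnion fun i =>
        (Set.finite_Iio n).biUnion fun m hm => (ih _ ?_).image _)
      have := Set.mem_Iio.1 hm
      omega
    refine h1.subset fun w hw => ?_
    rcases w with _ | ⟨⟨i, m⟩, w⟩
    · exact Or.inl rfl
    · have hw : wordDeg ((i, m) :: w) = n := hw
      rw [wordDeg_cons] at hw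
      refine Or.inr (Set.mem_iUnion.2 ⟨i, Set.mem_iUnion₂.2 ⟨m, ?_, w, ?_, rfl⟩⟩)
      · exact Set.mem_Iio.2 (by simp only at hw; omega)
      · change wordDeg w = n - (m + 1)
        simp only at hw; omega

/-- The words of conformal weight `n`. -/
abbrev WordOf (n : ℕ) : Type := {w : Word // wordDeg w = n}

instance (n : ℕ) : Finite (WordOf n) := (finite_wordDeg n).to_subtype

instance (n : ℕ) : Fintype (WordOf n) := Fintype.ofFinite _

/-! ### Weight spaces of quotients of relaxed Verma modules -/

section Quotient

variable {M : Type} [AddCommGroup M] [Module ℂ M] (k Δ : ℂ) (ρ : Sl2 →ₗ⁅ℂ⁆ Module.End ℂ M)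
  (N : Submodule UAff (RelaxedVerma k Δ ρ))
  {ι : Type} (b : ι → M) (wt : ι → ℂ)

/-- The image in a quotient of a relaxed Verma module of a word applied to a ground state. -/
def wordVec (p : Word × ι) : RelaxedVerma k Δ ρ ⧸ N :=
  Submodule.Quotient.mk (wordElt p.1 • groundMap k Δ ρ (b p.2))

theorem span_wordVec (hb : Submodule.span ℂ (Set.range b) = ⊤) :
    Submodule.span ℂ (Set.range (wordVec k Δ ρ N b)) = ⊤ := by
  rw [eq_top_iff]
  intro v _
  obtain ⟨v, rfl⟩ := Submodule.Quotient.mk_surjective _ v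
  let S := (Submodule.span ℂ (Set.range (wordVec k Δ ρ N b))).comap
    (N.mkQ.restrictScalars ℂ)
  refine relaxedVerma_induction k Δ ρ S (fun w m => ?_) v
  have hm : m ∈ Submodule.span ℂ (Set.range b) := by rw [hb]; trivial
  refine Submodule.span_induction ?_ ?_ (fun x y _ _ hx hy => ?_) (fun c x _ hx => ?_) hm
  · rintro _ ⟨i, rfl⟩
    exact Submodule.subset_span ⟨(w, i), rfl⟩
  · rw [map_zero, smul_zero]; exact S.zero_mem
  · rw [map_add, smul_add]; exact S.add_mem hx hy
  · rw [map_smul, smul_comm]; exact S.smul_mem _ hx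

variable (hwt : ∀ i, ρ Sl2.h (b i) = wt i • b i)

include hwt in
theorem h_smul_wordVec (p : Word × ι) : toU (mode Sl2.h 0) • wordVec k Δ ρ N b p =
    (wt p.2 + wordWt p.1 * 2) • wordVec k Δ ρ N b p := by
  rw [wordVec, ← Submodule.Quotient.mk_smul, h_smul_word k Δ ρ p.1 (hwt p.2)]
  rfl

theorem L0_smul_wordVec (p : Word × ι) : toU L0 • wordVec k Δ ρ N b p =
    (Δ + wordDeg p.1) • wordVec k Δ ρ N b p := by
  rw [wordVec, ← Submodule.Quotient.mk_smul, L0_smul_word]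
  rfl

include hwt in
theorem weightSpace_quotient (hb : Submodule.span ℂ (Set.range b) = ⊤) (μ n : ℂ) :
    weightSpace (RelaxedVerma k Δ ρ ⧸ N) μ n = Submodule.span ℂ (wordVec k Δ ρ N b ''
      {p | wt p.2 + wordWt p.1 * 2 = μ ∧ Δ + wordDeg p.1 = n}) :=
  weightSpace_eq_span _ (wordVec k Δ ρ N b) _ _ (h_smul_wordVec k Δ ρ N b wt hwt)
    (L0_smul_wordVec k Δ ρ N b) (span_wordVec k Δ ρ N b hb) μ n

include hwt in
theorem isWeightModule_quotient (hb : Submodule.span ℂ (Set.range b) = ⊤)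
    (hinj : Function.Injective wt) : IsWeightModule (RelaxedVerma k Δ ρ ⧸ N) k where
  level v := by
    obtain ⟨v, rfl⟩ := Submodule.Quotient.mk_surjective _ v
    rw [← Submodule.Quotient.mk_smul, K_smul]
    rfl
  iSup_weightSpace := iSup_weightSpace_of_span _ (wordVec k Δ ρ N b) _ _
    (h_smul_wordVec k Δ ρ N b wt hwt) (L0_smul_wordVec k Δ ρ N b) (span_wordVec k Δ ρ N b hb)
  finite_weightSpace μ n := by
    rw [weightSpace_quotient k Δ ρ N b wt hwt hb]
    refine FiniteDimensional.span_of_finite ℂ (Set.Finite.image _ ?_)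
    by_cases hn : ∃ d : ℕ, Δ + d = n
    · obtain ⟨d, rfl⟩ := hn
      -- For a fixed total weight the word determines the ground state, because `wt` is injective.
      -- So it is enough that finitely many words have the given degree.
      refine Set.Finite.of_finite_image (f := Prod.fst)
        ((finite_wordDeg d).subset ?_) ?_
      · rintro _ ⟨p, ⟨_, hp⟩, rfl⟩
        exact_mod_cast add_left_cancel hp
      · rintro ⟨w, i⟩ ⟨hi, _⟩ ⟨w', j⟩ ⟨hj, _⟩ h
        obtain rfl : w = w' := h
        exact Prod.ext rfl (hinj (add_right_cancel (hi.trans hj.symm)))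
    · convert Set.finite_empty
      exact Set.eq_empty_of_forall_notMem fun p hp => hn ⟨_, hp.2⟩

include hwt in
theorem weightSpace_quotient_eq_bot (hb : Submodule.span ℂ (Set.range b) = ⊤) (μ n : ℂ)
    (h : ∀ (w : Word) (i : ι), wt i + wordWt w * 2 = μ → Δ + wordDeg w = n → False) :
    weightSpace (RelaxedVerma k Δ ρ ⧸ N) μ n = ⊥ := by
  rw [weightSpace_quotient k Δ ρ N b wt hwt hb, Submodule.span_eq_bot]
  rintro _ ⟨p, hp, rfl⟩
  exact (h _ _ hp.1 hp.2).elim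

end Quotient

/-! ### Kernels of polynomial families of matrices -/

section PolyKer

variable {I W : Type*} [Fintype W]

/-- The kernel of the specialisation at `μ` of a matrix of polynomials with finitely many
columns. -/
def polyKer (A : I → W → Polynomial ℂ) (μ : ℂ) : Submodule ℂ (W → ℂ) where
  carrier := {c | ∀ i, ∑ w, (A i w).eval μ * c w = 0}
  zero_mem' i := by simp
  add_mem' {c c'} h h' i := by
    simp only [Pi.add_apply, mul_add, Finset.sum_add_distrib, h i, h' i, add_zero]
  smul_mem' r c h i := by
    simp only [Pi.smul_apply, smul_eq_mul, mul_left_comm _ r, ← Finset.mul_sum, h i, mul_zero]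

theorem finrank_ker_of_surjective {κ : Type*} [Fintype κ] (B : Matrix κ W ℂ)
    (h : Function.Surjective B.mulVec) :
    Module.finrank ℂ (LinearMap.ker B.mulVecLin) + Fintype.card κ = Fintype.card W := by
  have h1 := LinearMap.finrank_range_add_finrank_ker B.mulVecLin
  rw [LinearMap.range_eq_top.2 h, finrank_top, Module.finrank_fintype_fun_eq_card,
    Module.finrank_fintype_fun_eq_card] at h1
  omega

/-- For a matrix of polynomials with finitely many columns, there are finitely many rows that, away
from finitely many exceptional points, cut out the kernel, whose dimension is then constant. -/
theorem exists_generic_polyKer (A : I → W → Polynomial ℂ) :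
    ∃ (κ : Finset I) (d : ℕ) (S : Finset ℂ), ∀ μ ∉ S,
      Module.finrank ℂ (polyKer A μ) = d ∧
      ∀ c : W → ℂ, (∀ i ∈ κ, ∑ w, (A i w).eval μ * c w = 0) → c ∈ polyKer A μ := by
  classical
  -- At μ₀ the kernel is as small as possible. The rows κ chosen next are a basis of the row space
  -- at this point.
  obtain ⟨μ₀, hμ₀⟩ : ∃ μ₀, ∀ μ, Module.finrank ℂ (polyKer A μ₀) ≤ Module.finrank ℂ (polyKer A μ) :=
    ⟨Function.argmin fun μ => Module.finrank ℂ (polyKer A μ), fun μ =>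
      Function.argmin_le (fun μ => Module.finrank ℂ (polyKer A μ)) μ⟩
  obtain ⟨κ, a, _, hsp, hli⟩ := exists_linearIndependent' ℂ fun i w => (A i w).eval μ₀
  have : Finite κ := hli.finite
  have : Fintype κ := Fintype.ofFinite κ
  let B : ℂ → Matrix κ W ℂ := fun μ => Matrix.of fun r w => (A (a r) w).eval μ
  have hmem : ∀ μ c, c ∈ LinearMap.ker (B μ).mulVecLin ↔
      ∀ r, ∑ w, (A (a r) w).eval μ * c w = 0 := by
    intro μ c
    rw [LinearMap.mem_ker, Matrix.mulVecLin_apply, funext_iff]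
    rfl
  have hle : ∀ μ, polyKer A μ ≤ LinearMap.ker (B μ).mulVecLin :=
    fun μ c hc => (hmem μ c).2 fun r => hc (a r)
  have hle₀ : LinearMap.ker (B μ₀).mulVecLin ≤ polyKer A μ₀ := by
    intro c hc i
    rw [hmem] at hc
    let φ : (W → ℂ) →ₗ[ℂ] ℂ := ∑ w, c w • LinearMap.proj w
    have hφ : ∀ v : W → ℂ, φ v = ∑ w, v w * c w := by
      intro v
      simp [φ, mul_comm]
    have h1 : (fun w => (A i w).eval μ₀) ∈ LinearMap.ker φ := by
      have h2 : (fun w => (A i w).eval μ₀) ∈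
          Submodule.span ℂ (Set.range fun i w => (A i w).eval μ₀) := Submodule.subset_span ⟨i, rfl⟩
      rw [← hsp] at h2
      refine (Submodule.span_le.2 ?_) h2
      rintro _ ⟨r, rfl⟩
      change φ _ = 0
      rw [hφ]
      exact hc r
    rw [LinearMap.mem_ker, hφ] at h1
    exact h1
  have hsurj₀ : Function.Surjective (B μ₀).mulVec := by
    have h1 : (B μ₀).rank = Fintype.card κ := LinearIndependent.rank_matrix hli
    have h2 : LinearMap.range (B μ₀).mulVecLin = ⊤ := by
      apply Submodule.eq_top_of_finrank_eq
      rw [Module.finrank_fintype_fun_eq_card]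
      exact h1
    exact LinearMap.range_eq_top.1 h2
  obtain ⟨C, hC⟩ := Matrix.mulVec_surjective_iff_exists_right_inverse.1 hsurj₀
  -- With C a right inverse of B(μ₀), the polynomial det(B(μ) C) takes the value 1 at μ₀. Away from
  -- its finitely many roots B(μ) is surjective.
  let P : Polynomial ℂ :=
    ((Matrix.of fun r w => A (a r) w : Matrix κ W (Polynomial ℂ)) * C.map Polynomial.C).det
  have hP : ∀ μ, P.eval μ = (B μ * C).det := by
    intro μ
    rw [← Polynomial.coe_evalRingHom, RingHom.map_det]
    congr 1
    ext r r'
    simp [Matrix.mul_apply, B, Polynomial.eval_finsetSum]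
  have hP₀ : P ≠ 0 := by
    intro h
    have h1 := hP μ₀
    rw [hC, h, Matrix.det_one] at h1
    simp at h1
  refine ⟨Finset.univ.image a, Module.finrank ℂ (polyKer A μ₀), P.roots.toFinset, fun μ hμ => ?_⟩
  have hdet : (B μ * C).det ≠ 0 := by
    rw [← hP]
    intro h
    exact hμ (Multiset.mem_toFinset.2 ((Polynomial.mem_roots hP₀).2 h))
  have hsurj : Function.Surjective (B μ).mulVec := by
    intro y
    refine ⟨C.mulVec ((B μ * C)⁻¹.mulVec y), ?_⟩
    rw [Matrix.mulVec_mulVec, Matrix.mulVec_mulVec,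
      Matrix.mul_nonsing_inv _ (isUnit_iff_ne_zero.2 hdet), Matrix.one_mulVec]
  have h1 := finrank_ker_of_surjective (B μ) hsurj
  -- The dimensions satisfy ker B(μ) = ker B(μ₀) ≤ `polyKer A μ₀` ≤ `polyKer A μ` ≤ ker B(μ), so
  -- equality holds throughout.
  have h2 := finrank_ker_of_surjective (B μ₀) hsurj₀
  have h3 := Submodule.finrank_mono hle₀
  have h4 := Submodule.finrank_mono (hle μ)
  have h5 := hμ₀ μ
  refine ⟨by omega, fun c hc => ?_⟩
  rw [Submodule.eq_of_le_of_finrank_le (hle μ) (by omega), hmem]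
  exact fun r => hc _ (Finset.mem_image_of_mem a (Finset.mem_univ r))

end PolyKer

/-! ### Functoriality -/

section Functoriality

variable {M M' : Type} [AddCommGroup M] [Module ℂ M] [AddCommGroup M'] [Module ℂ M'] (k Δ : ℂ)
  (ρ : Sl2 →ₗ⁅ℂ⁆ Module.End ℂ M) (ρ' : Sl2 →ₗ⁅ℂ⁆ Module.End ℂ M')
  (φ : M →ₗ[ℂ] M') (hφ : ∀ x m, φ (ρ x m) = ρ' x (φ m))

include hφ in
theorem map_inflate (x : affineGe) (m : M) :
    φ (inflate k Δ ρ x m) = inflate k Δ ρ' x (φ m) := by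
  change φ (ρ (x.1.loop 0) m + (x.1.central * k + x.1.energy * Δ) • m) =
    ρ' (x.1.loop 0) (φ m) + (x.1.central * k + x.1.energy * Δ) • φ m
  rw [map_add, map_smul, hφ]

/-- The map of relaxed Verma modules induced by a homomorphism of `sl(2)`-modules. -/
def relaxedMap : RelaxedVerma k Δ ρ →ₗ[UAff] RelaxedVerma k Δ ρ' :=
  Submodule.mapQ _ _
    (TensorProduct.AlgebraTensorModule.map (LinearMap.id : UAff →ₗ[UAff] UAff) φ) (by
      refine Submodule.span_le.2 ?_
      rintro _ ⟨u, x, m, rfl⟩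
      refine Submodule.subset_span ⟨u, x, φ m, ?_⟩
      rw [map_sub, TensorProduct.AlgebraTensorModule.map_tmul,
        TensorProduct.AlgebraTensorModule.map_tmul, map_inflate k Δ ρ ρ' φ hφ]
      rfl)

theorem relaxedMap_groundMap (m : M) :
    relaxedMap k Δ ρ ρ' φ hφ (groundMap k Δ ρ m) = groundMap k Δ ρ' (φ m) := rfl

theorem relaxedMap_smul_groundMap (u : UAff) (m : M) :
    relaxedMap k Δ ρ ρ' φ hφ (u • groundMap k Δ ρ m) = u • groundMap k Δ ρ' (φ m) :=
  (relaxedMap k Δ ρ ρ' φ hφ).map_smul u _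

theorem relaxedMap_smul (c : ℂ) (v : RelaxedVerma k Δ ρ) :
    relaxedMap k Δ ρ ρ' φ hφ (c • v) = c • relaxedMap k Δ ρ ρ' φ hφ v :=
  LinearMap.map_smul_of_tower _ c v

theorem groundProj_relaxedMap (v : RelaxedVerma k Δ ρ) :
    groundProj k Δ ρ' (relaxedMap k Δ ρ ρ' φ hφ v) = φ (groundProj k Δ ρ v) := by
  refine DFunLike.congr_fun (relaxedVerma_hom_ext k Δ ρ
    (φ := groundProj k Δ ρ' ∘ₗ (relaxedMap k Δ ρ ρ' φ hφ).restrictScalars ℂ)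
    (ψ := φ ∘ₗ groundProj k Δ ρ) fun w m => ?_) v
  change groundProj k Δ ρ' (relaxedMap k Δ ρ ρ' φ hφ (wordElt w • groundMap k Δ ρ m)) =
    φ (groundProj k Δ ρ (wordElt w • groundMap k Δ ρ m))
  rw [map_smul, relaxedMap_groundMap]
  rcases w with _ | ⟨a, w⟩
  · rw [wordElt_nil, one_smul, one_smul, groundProj_groundMap, groundProj_groundMap]
  · rw [groundProj_wordElt_cons, groundProj_wordElt_cons, map_zero]

end Functoriality

/-! ### The family of dense modules -/

/-- The coefficient `γ_{X + jα}`, as a polynomial in the weight `X`. -/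
def polyGam (q : ℂ) (j : ℤ) : Polynomial ℂ :=
  Polynomial.C (1 / 2) * (Polynomial.C q - Polynomial.C (1 / 2) *
    ((Polynomial.X + Polynomial.C (2 * j : ℂ)) * (Polynomial.X + Polynomial.C (2 * j + 2 : ℂ))))

/-- The dense module with weights `X + jα`, for `X` an indeterminate. -/
def polyRep (q : ℂ) : Sl2 →ₗ⁅ℂ⁆ Module.End ℂ (ℤ →₀ Polynomial ℂ) :=
  sl2Rep
    (Finsupp.lsum ℂ fun j => Finsupp.lsingle (j + 1) ∘ₗ LinearMap.mulLeft ℂ (polyGam q j))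
    (Finsupp.lsum ℂ fun j => Finsupp.lsingle j ∘ₗ
      LinearMap.mulLeft ℂ (Polynomial.X + Polynomial.C (2 * j : ℂ)))
    (Finsupp.lsum ℂ fun j => Finsupp.lsingle (j - 1))
    (by
      refine Finsupp.lhom_ext fun j p => ?_
      simp only [Module.End.mul_apply, LinearMap.sub_apply, LinearMap.smul_apply,
        Finsupp.lsum_single, LinearMap.comp_apply, Finsupp.lsingle_apply,
        LinearMap.mulLeft_apply, ← Finsupp.single_sub, Finsupp.smul_single]
      congr 1
      refine Polynomial.funext fun x => ?_
      simp
      ring)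
    (by
      refine Finsupp.lhom_ext fun j p => ?_
      simp only [Module.End.mul_apply, LinearMap.sub_apply,
        Finsupp.lsum_single, LinearMap.comp_apply, Finsupp.lsingle_apply,
        LinearMap.mulLeft_apply, sub_add_cancel, add_sub_cancel_right, ← Finsupp.single_sub]
      congr 1
      refine Polynomial.funext fun x => ?_
      simp [polyGam]
      ring)
    (by
      refine Finsupp.lhom_ext fun j p => ?_
      simp only [Module.End.mul_apply, LinearMap.sub_apply, LinearMap.smul_apply,
        Finsupp.lsum_single, LinearMap.comp_apply, Finsupp.lsingle_apply,
        LinearMap.mulLeft_apply, ← Finsupp.single_sub, Finsupp.smul_single]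
      congr 1
      refine Polynomial.funext fun x => ?_
      simp
      ring)

theorem sl2Rep_e {M : Type*} [AddCommGroup M] [Module ℂ M] (E H F : Module.End ℂ M) (h₁ h₂ h₃) :
    sl2Rep E H F h₁ h₂ h₃ Sl2.e = E := by
  change (Sl2.e.1 0 1 • E + Sl2.e.1 0 0 • H + Sl2.e.1 1 0 • F) = E
  simp [Sl2.e]

theorem sl2Rep_h {M : Type*} [AddCommGroup M] [Module ℂ M] (E H F : Module.End ℂ M) (h₁ h₂ h₃) :
    sl2Rep E H F h₁ h₂ h₃ Sl2.h = H := by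
  change (Sl2.h.1 0 1 • E + Sl2.h.1 0 0 • H + Sl2.h.1 1 0 • F) = H
  simp [Sl2.h]

theorem sl2Rep_f {M : Type*} [AddCommGroup M] [Module ℂ M] (E H F : Module.End ℂ M) (h₁ h₂ h₃) :
    sl2Rep E H F h₁ h₂ h₃ Sl2.f = F := by
  change (Sl2.f.1 0 1 • E + Sl2.f.1 0 0 • H + Sl2.f.1 1 0 • F) = F
  simp [Sl2.f]

/-- A linear map between two `sl(2)`-modules that commutes with `e`, `h` and `f` is a
homomorphism. -/
theorem map_rep_of_gens {M M' : Type*} [AddCommGroup M] [Module ℂ M] [AddCommGroup M'] [Module ℂ M']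
    (ρ : Sl2 →ₗ⁅ℂ⁆ Module.End ℂ M) (ρ' : Sl2 →ₗ⁅ℂ⁆ Module.End ℂ M') (φ : M →ₗ[ℂ] M')
    (he : φ ∘ₗ ρ Sl2.e = ρ' Sl2.e ∘ₗ φ) (hh : φ ∘ₗ ρ Sl2.h = ρ' Sl2.h ∘ₗ φ)
    (hf : φ ∘ₗ ρ Sl2.f = ρ' Sl2.f ∘ₗ φ) (x : Sl2) (m : M) : φ (ρ x m) = ρ' x (φ m) := by
  have he := DFunLike.congr_fun he m
  have hh := DFunLike.congr_fun hh m
  have hf := DFunLike.congr_fun hf m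
  simp only [LinearMap.comp_apply] at he hh hf
  rw [sl2_eq x]
  change φ (ρ (_ • Sl2.f + _ • Sl2.h + _ • Sl2.e) m) =
    ρ' (_ • Sl2.f + _ • Sl2.h + _ • Sl2.e) (φ m)
  simp only [map_add, map_smul, LinearMap.add_apply, LinearMap.smul_apply, he, hh, hf]

section Dense

variable {lam : ℂ ⧸ rootLattice}

/-- Translation of the weights in a coset by a multiple of the simple root. -/
def CosetWeights.shift (μ : CosetWeights lam) (j : ℤ) : CosetWeights lam :=
  ⟨μ.1 + 2 * j, by
    refine Eq.trans (QuotientAddGroup.eq.mpr ?_) μ.2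
    rw [AddSubgroup.mem_zmultiples_iff]
    exact ⟨-j, by simp [mul_comm]⟩⟩

theorem CosetWeights.shift_coe (μ : CosetWeights lam) (j : ℤ) : (μ.shift j).1 = μ.1 + 2 * j := rfl

theorem CosetWeights.shift_up (μ : CosetWeights lam) (j : ℤ) : (μ.shift j).up = μ.shift (j + 1) :=
  Subtype.ext (by simp [CosetWeights.shift, CosetWeights.up]; ring)

theorem CosetWeights.shift_down (μ : CosetWeights lam) (j : ℤ) :
    (μ.shift j).down = μ.shift (j - 1) :=
  Subtype.ext (by simp [CosetWeights.shift, CosetWeights.down]; ring)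

theorem CosetWeights.shift_injective (μ : CosetWeights lam) : Function.Injective μ.shift := by
  intro i j h
  have h1 := congr_arg Subtype.val h
  rw [shift_coe, shift_coe] at h1
  have h2 : (2 : ℂ) ≠ 0 := two_ne_zero
  exact_mod_cast mul_left_cancel₀ h2 (add_left_cancel h1)

theorem CosetWeights.exists_shift_eq (μ ν : CosetWeights lam) : ∃ j, μ.shift j = ν := by
  have h := QuotientAddGroup.eq.mp (μ.2.trans ν.2.symm)
  rw [AddSubgroup.mem_zmultiples_iff] at h
  obtain ⟨j, hj⟩ := h
  refine ⟨j, Subtype.ext ?_⟩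
  rw [shift_coe, mul_comm, ← zsmul_eq_mul, hj]
  ring

variable (q : ℂ)

theorem denseRep_e (μ : CosetWeights lam) (c : ℂ) :
    denseRep q lam Sl2.e (Finsupp.single μ c) = Finsupp.single μ.up (c * gam q μ.1) := by
  rw [denseRep, sl2Rep_e, Finsupp.linearCombination_single, Finsupp.smul_single, smul_eq_mul]

theorem denseRep_h (μ : CosetWeights lam) (c : ℂ) :
    denseRep q lam Sl2.h (Finsupp.single μ c) = Finsupp.single μ (c * μ.1) := by
  rw [denseRep, sl2Rep_h, Finsupp.linearCombination_single, Finsupp.smul_single, smul_eq_mul]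

theorem denseRep_f (μ : CosetWeights lam) (c : ℂ) :
    denseRep q lam Sl2.f (Finsupp.single μ c) = Finsupp.single μ.down c := by
  rw [denseRep, sl2Rep_f, Finsupp.linearCombination_single, Finsupp.smul_single, smul_eq_mul,
    mul_one]

theorem denseRep_f_injective : Function.Injective (denseRep q lam Sl2.f) := by
  have h : ∀ v, denseRep q lam Sl2.f v = Finsupp.mapDomain CosetWeights.down v := by
    intro v
    induction v using Finsupp.induction_linear with
    | zero => simp
    | add v w hv hw => rw [map_add, hv, hw, Finsupp.mapDomain_add]
    | single μ c => rw [denseRep_f, Finsupp.mapDomain_single]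
  intro v w hvw
  rw [h, h] at hvw
  exact Finsupp.mapDomain_injective
    (Function.LeftInverse.injective fun μ => CosetWeights.up_down μ) hvw

/-- The specialisation `X ↦ μ`. -/
def evalMap (μ : CosetWeights lam) : (ℤ →₀ Polynomial ℂ) →ₗ[ℂ] (CosetWeights lam →₀ ℂ) :=
  Finsupp.lsum ℂ fun j => Finsupp.lsingle (μ.shift j) ∘ₗ Polynomial.leval μ.1

theorem evalMap_single (μ : CosetWeights lam) (j : ℤ) (p : Polynomial ℂ) :
    evalMap μ (Finsupp.single j p) = Finsupp.single (μ.shift j) (p.eval μ.1) := by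
  simp [evalMap]

theorem evalMap_apply_shift (μ : CosetWeights lam) (v : ℤ →₀ Polynomial ℂ) (j : ℤ) :
    evalMap μ v (μ.shift j) = (v j).eval μ.1 := by
  induction v using Finsupp.induction_linear with
  | zero => simp
  | add v w hv hw => simp [hv, hw]
  | single i p =>
    rw [evalMap_single]
    by_cases h : i = j
    · subst h; simp
    · rw [Finsupp.single_eq_of_ne, Finsupp.single_eq_of_ne]
      · simp
      · exact fun h' => h h'.symm
      · exact fun h' => h (μ.shift_injective h').symm

theorem evalMap_rep (μ : CosetWeights lam) (x : Sl2) (v : ℤ →₀ Polynomial ℂ) :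
    evalMap μ (polyRep q x v) = denseRep q lam x (evalMap μ v) := by
  refine map_rep_of_gens _ _ _ ?_ ?_ ?_ x v
  · refine Finsupp.lhom_ext fun j p => ?_
    rw [LinearMap.comp_apply, LinearMap.comp_apply, evalMap_single, denseRep_e, polyRep, sl2Rep_e,
      CosetWeights.shift_up, CosetWeights.shift_coe, Finsupp.lsum_single]
    simp only [LinearMap.comp_apply, Finsupp.lsingle_apply, LinearMap.mulLeft_apply,
      evalMap_single]
    congr 1
    simp [polyGam, gam, weightForm]
    ring
  · refine Finsupp.lhom_ext fun j p => ?_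
    rw [LinearMap.comp_apply, LinearMap.comp_apply, evalMap_single, denseRep_h, polyRep, sl2Rep_h,
      CosetWeights.shift_coe, Finsupp.lsum_single]
    simp only [LinearMap.comp_apply, Finsupp.lsingle_apply, LinearMap.mulLeft_apply,
      evalMap_single]
    congr 1
    simp
    ring
  · refine Finsupp.lhom_ext fun j p => ?_
    rw [LinearMap.comp_apply, LinearMap.comp_apply, evalMap_single, denseRep_f, polyRep, sl2Rep_f,
      CosetWeights.shift_down, Finsupp.lsum_single]
    simp only [Finsupp.lsingle_apply, evalMap_single]

variable (k Δ : ℂ)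

/-- The matrix of polynomials that describes the ground components of the descendants of the words
of conformal weight `n`, applied to ground states of the appropriate weights. -/
def pairing (n : ℕ) (i : UAff × ℤ) (w : WordOf n) : Polynomial ℂ :=
  groundProj k Δ (polyRep q) (i.1 • wordElt w.1 •
    groundMap k Δ (polyRep q) (Finsupp.single (-wordWt w.1) 1)) i.2

/-- The linear combinations of words of conformal weight `n` applied to ground states, of weight
`μ`. -/
def wordComb (n : ℕ) (μ : CosetWeights lam) :
    (WordOf n → ℂ) →ₗ[ℂ] RelaxedVerma k Δ (denseRep q lam) :=
  Fintype.linearCombination ℂ fun w : WordOf n =>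
    wordElt w.1 • groundMap k Δ (denseRep q lam) (Finsupp.single (μ.shift (-wordWt w.1)) 1)

/-- The combination is the specialisation X ↦ μ of a vector of the module induced from the
polynomial family, and specialisation commutes with the enveloping algebra and with the ground
projection. -/
theorem groundProj_wordComb (n : ℕ) (μ : CosetWeights lam) (c : WordOf n → ℂ) (u : UAff) (j : ℤ) :
    groundProj k Δ (denseRep q lam) (u • wordComb q k Δ n μ c) (μ.shift j) =
      ∑ w, (pairing q k Δ n (u, j) w).eval μ.1 * c w := by
  have h : wordComb q k Δ n μ c = relaxedMap k Δ (polyRep q) (denseRep q lam) (evalMap μ)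
      (evalMap_rep q μ) (∑ w : WordOf n, c w • wordElt w.1 •
        groundMap k Δ (polyRep q) (Finsupp.single (-wordWt w.1) 1)) := by
    rw [map_sum, wordComb, Fintype.linearCombination_apply]
    refine Finset.sum_congr rfl fun w _ => ?_
    rw [relaxedMap_smul, map_smul, relaxedMap_groundMap, evalMap_single, Polynomial.eval_one]
  rw [h, ← map_smul, groundProj_relaxedMap, evalMap_apply_shift, Finset.smul_sum, map_sum,
    Finsupp.finsetSum_apply, Polynomial.eval_finsetSum]
  refine Finset.sum_congr rfl fun w _ => ?_
  rw [smul_comm, map_smul, Finsupp.smul_apply, Polynomial.eval_smul, smul_eq_mul, mul_comm]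
  rfl

/-- Every weight of the coset is μ + jα for some j, so the rows (u, j) together record all ground
components of all descendants. -/
theorem wordComb_mem_radical (n : ℕ) (μ : CosetWeights lam) (c : WordOf n → ℂ) :
    wordComb q k Δ n μ c ∈ radical k Δ (denseRep q lam) ↔ c ∈ polyKer (pairing q k Δ n) μ.1 := by
  constructor
  · rintro h ⟨u, j⟩
    rw [← groundProj_wordComb, h u]
    rfl
  · intro h u
    ext ν
    obtain ⟨j, rfl⟩ := μ.exists_shift_eq ν
    rw [groundProj_wordComb, h (u, j)]
    rfl

end Dense

/-! ### Dimensions of weight spaces from relations between words -/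

section Dimension

variable {M : Type} [AddCommGroup M] [Module ℂ M] (k Δ : ℂ) (ρ : Sl2 →ₗ⁅ℂ⁆ Module.End ℂ M)
  (N : Submodule UAff (RelaxedVerma k Δ ρ))
  {ι : Type} (b : ι → M) (wt : ι → ℂ) (hwt : ∀ i, ρ Sl2.h (b i) = wt i • b i)

include hwt in
/-- The dimension of a weight space of a quotient of a relaxed Verma module, in terms of the linear
relations between the words applied to ground states. -/
theorem finrank_weightSpace_quotient (hb : Submodule.span ℂ (Set.range b) = ⊤)
    (hinj : Function.Injective wt) (μ : ℂ) (n : ℕ) (g : WordOf n → ι) (s : WordOf n → ℂ)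
    (hs : ∀ w, s w ≠ 0) (hg : ∀ w, wt (g w) + wordWt w.1 * 2 = μ)
    (K : Submodule ℂ (WordOf n → ℂ))
    (hK : ∀ c : WordOf n → ℂ, ∑ w, c w • s w • wordVec k Δ ρ N b (w.1, g w) = 0 ↔ c ∈ K) :
    Module.finrank ℂ (weightSpace (RelaxedVerma k Δ ρ ⧸ N) μ (Δ + n)) + Module.finrank ℂ K =
      Fintype.card (WordOf n) := by
  let Ψ : (WordOf n → ℂ) →ₗ[ℂ] (RelaxedVerma k Δ ρ ⧸ N) :=
    Fintype.linearCombination ℂ fun w => s w • wordVec k Δ ρ N b (w.1, g w)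
  have hker : LinearMap.ker Ψ = K := by
    ext c
    rw [LinearMap.mem_ker, ← hK, Fintype.linearCombination_apply]
  have hrange : LinearMap.range Ψ = weightSpace (RelaxedVerma k Δ ρ ⧸ N) μ (Δ + n) := by
    rw [weightSpace_quotient k Δ ρ N b wt hwt hb, Fintype.range_linearCombination]
    apply le_antisymm
    · rw [Submodule.span_le]
      rintro _ ⟨w, rfl⟩
      refine Submodule.smul_mem _ _ (Submodule.subset_span ⟨(w.1, g w), ⟨hg w, ?_⟩, rfl⟩)
      rw [w.2]
    · rw [Submodule.span_le]
      rintro _ ⟨⟨w, i⟩, ⟨hi, hw'⟩, rfl⟩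
      have hw : wordDeg w = n := by exact_mod_cast add_left_cancel hw'
      obtain rfl : i = g ⟨w, hw⟩ :=
        hinj (add_right_cancel (hi.trans (hg ⟨w, hw⟩).symm))
      rw [SetLike.mem_coe, ← inv_smul_smul₀ (hs ⟨w, hw⟩) (wordVec k Δ ρ N b _)]
      exact Submodule.smul_mem _ _ (Submodule.subset_span ⟨⟨w, hw⟩, rfl⟩)
  rw [← hker, ← hrange, LinearMap.finrank_range_add_finrank_ker,
    Module.finrank_fintype_fun_eq_card]

theorem f_smul_mem_weightSpace {V : Type} [AddCommGroup V] [Module UAff V] [Module ℂ V]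
    [IsScalarTower ℂ UAff V] {μ n : ℂ} {v : V} (hv : v ∈ weightSpace V μ n) :
    toU (mode Sl2.f 0) • v ∈ weightSpace V (μ - 2) n := by
  refine ⟨?_, ?_⟩
  · have h1 : toU (mode Sl2.h 0) • v = μ • v := Module.End.mem_eigenspace_iff.1 hv.1
    refine Module.End.mem_eigenspace_iff.2 ?_
    change toU (mode Sl2.h 0) • toU (mode Sl2.f 0) • v = (μ - 2) • toU (mode Sl2.f 0) • v
    rw [← mul_smul, toU_mul_toU, lie_mode_of_ne _ _ _ _ (Or.inl rfl), zero_add, Sl2.lie_h_f, mode_smul,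
      toU_smul, add_smul, mul_smul, h1, smul_assoc, smul_comm, ← add_smul, sub_eq_add_neg]
  · refine Module.End.mapsTo_maxGenEigenspace_of_comm (act_commute V ?_) n hv.2
    rw [lie_L0_mode]; simp

end Dimension

/-! ### Constancy of the dimensions along a coset -/

section Dense

variable (k Δ q : ℂ) {lam : ℂ ⧸ rootLattice}
  (N : Submodule UAff (RelaxedVerma k Δ (denseRep q lam)))

theorem span_single {ι : Type} :
    Submodule.span ℂ (Set.range fun i : ι => Finsupp.single i (1 : ℂ)) = ⊤ := by
  have := (Finsupp.basisSingleOne (R := ℂ) (ι := ι)).span_eq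
  simpa using this

theorem denseRep_h_single (μ : CosetWeights lam) :
    denseRep q lam Sl2.h (Finsupp.single μ 1) = μ.1 • Finsupp.single μ 1 := by
  rw [denseRep_h, Finsupp.smul_single, smul_eq_mul, mul_comm]

theorem isWeightModule_dense : IsWeightModule (RelaxedVerma k Δ (denseRep q lam) ⧸ N) k :=
  isWeightModule_quotient k Δ _ N (fun μ => Finsupp.single μ 1) Subtype.val
    (denseRep_h_single q) span_single Subtype.val_injective

theorem mk_wordComb (n : ℕ) (μ : CosetWeights lam) (c : WordOf n → ℂ) :
    (Submodule.Quotient.mk (wordComb q k Δ n μ c) : RelaxedVerma k Δ (denseRep q lam) ⧸ N) =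
      ∑ w, c w • (1 : ℂ) • wordVec k Δ (denseRep q lam) N (fun μ => Finsupp.single μ 1)
        (w.1, μ.shift (-wordWt w.1)) := by
  rw [wordComb, Fintype.linearCombination_apply]
  change N.mkQ _ = _
  rw [map_sum]
  refine Finset.sum_congr rfl fun w _ => ?_
  rw [one_smul]
  rfl

theorem finrank_weightSpace_dense (hN : N = radical k Δ (denseRep q lam)) (n : ℕ)
    (μ : CosetWeights lam) :
    Module.finrank ℂ (weightSpace (RelaxedVerma k Δ (denseRep q lam) ⧸ N) μ.1 (Δ + n)) +
      Module.finrank ℂ (polyKer (pairing q k Δ n) μ.1) = Fintype.card (WordOf n) := by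
  refine finrank_weightSpace_quotient k Δ _ N (fun μ => Finsupp.single μ 1) Subtype.val
    (denseRep_h_single q) span_single Subtype.val_injective μ.1 n
    (fun w => μ.shift (-wordWt w.1)) (fun _ => 1) (fun _ => one_ne_zero) (fun w => ?_) _
    (fun c => ?_)
  · rw [CosetWeights.shift_coe]
    push_cast
    ring
  · rw [← wordComb_mem_radical, ← hN, ← mk_wordComb, Submodule.Quotient.mk_eq_zero]

/-- The operator f₀ lowers the weight by α, preserves the conformal weight and is injective modulo
the radical. -/
theorem finrank_weightSpace_dense_le (hN : N = radical k Δ (denseRep q lam)) (n : ℂ)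
    (μ : CosetWeights lam) (j : ℕ) :
    Module.finrank ℂ (weightSpace (RelaxedVerma k Δ (denseRep q lam) ⧸ N) μ.1 n) ≤
    Module.finrank ℂ
      (weightSpace (RelaxedVerma k Δ (denseRep q lam) ⧸ N) (μ.shift (-j)).1 n) := by
  induction j with
  | zero =>
    have e : μ.shift (-(0 : ℕ)) = μ := Subtype.ext (by rw [CosetWeights.shift_coe]; simp)
    rw [e]
  | succ j ih =>
    refine ih.trans ?_
    let V := RelaxedVerma k Δ (denseRep q lam) ⧸ N
    have := (isWeightModule_dense k Δ q N).finite_weightSpace (μ.shift (-(j + 1 : ℕ))).1 n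
    have e : (μ.shift (-(j + 1 : ℕ))).1 = (μ.shift (-j)).1 - 2 := by
      rw [CosetWeights.shift_coe, CosetWeights.shift_coe]; push_cast; ring
    have hmap : ∀ v ∈ weightSpace V (μ.shift (-j)).1 n,
        act V (mode Sl2.f 0) v ∈ weightSpace V (μ.shift (-(j + 1 : ℕ))).1 n := by
      intro v hv
      rw [e]
      exact f_smul_mem_weightSpace hv
    refine LinearMap.finrank_le_finrank_of_injective
      (f := (act V (mode Sl2.f 0)).restrict hmap) ?_
    rw [← LinearMap.ker_eq_bot, LinearMap.ker_eq_bot']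
    rintro ⟨v, hv⟩ h
    have h1 : act V (mode Sl2.f 0) v = 0 := congr_arg Subtype.val h
    refine Subtype.ext ?_
    change v = 0
    obtain ⟨v, rfl⟩ := Submodule.Quotient.mk_surjective _ v
    have h2 : (Submodule.Quotient.mk (toU (mode Sl2.f 0) • v) : V) = 0 := h1
    rw [Submodule.Quotient.mk_eq_zero, hN] at h2
    rw [Submodule.Quotient.mk_eq_zero, hN]
    exact mem_radical_of_f_smul k Δ _ (denseRep_f_injective q) h2

theorem finite_shift_mem (μ : ℂ) (S : Finset ℂ) : {j : ℤ | μ + 2 * j ∈ S}.Finite := by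
  refine S.finite_toSet.preimage (f := fun j : ℤ => μ + 2 * j) (Function.Injective.injOn ?_)
  intro i j h
  have h2 : (2 : ℂ) ≠ 0 := two_ne_zero
  exact_mod_cast mul_left_cancel₀ h2 (add_left_cancel h)

/-- The string functions of a relaxed highest-weight module are given by the generic rank of the
pairing. -/
theorem finrank_weightSpace_dense_eq (hN : N = radical k Δ (denseRep q lam)) (n d : ℕ)
    (S : Finset ℂ) (hS : ∀ μ ∉ S, Module.finrank ℂ (polyKer (pairing q k Δ n) μ) = d)
    (μ : CosetWeights lam) :
    Module.finrank ℂ (weightSpace (RelaxedVerma k Δ (denseRep q lam) ⧸ N) μ.1 (Δ + n)) + d =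
      Fintype.card (WordOf n) := by
  have hfin := finite_shift_mem μ.1 S
  have key : ∀ j : ℤ, μ.1 + 2 * j ∉ S → Module.finrank ℂ
      (weightSpace (RelaxedVerma k Δ (denseRep q lam) ⧸ N) (μ.shift j).1 (Δ + n)) + d =
      Fintype.card (WordOf n) := by
    intro j hj
    rw [← finrank_weightSpace_dense k Δ q N hN n (μ.shift j), hS (μ.shift j).1 hj]
  -- The exceptional steps lie between c and a. The generic value therefore occurs at a step beyond
  -- max(a, 0) and at one below min(c, 0), and monotonicity traps the dimension at μ between the
  -- two.
  obtain ⟨a, ha⟩ := hfin.bddAbove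
  obtain ⟨c, hc⟩ := hfin.bddBelow
  have h1 := key ((max a 0).toNat + 1 : ℕ) (fun h => by
    have := ha h
    omega)
  have h2 := key (-((-(min c 0)).toNat + 1 : ℕ)) (fun h => by
    have := hc h
    push_cast at this
    omega)
  have h3 := finrank_weightSpace_dense_le k Δ q N hN (Δ + n)
    (μ.shift ((max a 0).toNat + 1 : ℕ)) ((max a 0).toNat + 1)
  have h4 := finrank_weightSpace_dense_le k Δ q N hN (Δ + n) μ ((-(min c 0)).toNat + 1)
  have h5 : (μ.shift ((max a 0).toNat + 1 : ℕ)).shift (-((max a 0).toNat + 1 : ℕ)) = μ :=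
    Subtype.ext (by rw [CosetWeights.shift_coe, CosetWeights.shift_coe]; push_cast; ring)
  rw [h5] at h3
  omega

end Dense

/-! ### Modules induced from lowest-weight Verma modules -/

section Lowest

variable (k Δ ν : ℂ)

theorem lowestVermaRep_e (j : ℕ) (c : ℂ) :
    lowestVermaRep ν Sl2.e (Finsupp.single j c) = Finsupp.single (j + 1) c := by
  rw [lowestVermaRep, sl2Rep_e, Finsupp.linearCombination_single, Finsupp.smul_single,
    smul_eq_mul, mul_one]

theorem lowestVermaRep_h (j : ℕ) (c : ℂ) :
    lowestVermaRep ν Sl2.h (Finsupp.single j c) = Finsupp.single j (c * (ν + 2 * j)) := by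
  rw [lowestVermaRep, sl2Rep_h, Finsupp.linearCombination_single, Finsupp.smul_single,
    smul_eq_mul]

theorem lowestVermaRep_f (j : ℕ) (c : ℂ) : lowestVermaRep ν Sl2.f (Finsupp.single j c) =
    Finsupp.single (j - 1) (c * -(j * (ν + j - 1))) := by
  rw [lowestVermaRep, sl2Rep_f, Finsupp.linearCombination_single, Finsupp.smul_single,
    smul_eq_mul]

theorem lowestVermaRep_h_single (j : ℕ) : lowestVermaRep ν Sl2.h (Finsupp.single j 1) =
    (ν + 2 * j) • Finsupp.single j 1 := by
  rw [lowestVermaRep_h, Finsupp.smul_single, smul_eq_mul, mul_comm]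

theorem lowestVermaRep_f_apply (m : ℕ →₀ ℂ) (j : ℕ) :
    lowestVermaRep ν Sl2.f m j = -((j + 1) * (ν + j)) * m (j + 1) := by
  induction m using Finsupp.induction_linear with
  | zero => simp
  | add m m' h h' => rw [map_add, Finsupp.add_apply, Finsupp.add_apply, h, h']; ring
  | single i c =>
    rw [lowestVermaRep_f]
    rcases i with _ | i
    · rw [Finsupp.single_eq_of_ne (show j + 1 ≠ 0 by omega)]
      simp
    · rw [Nat.add_sub_cancel]
      by_cases h : i = j
      · subst h
        rw [Finsupp.single_eq_same, Finsupp.single_eq_same]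
        push_cast
        ring
      · rw [Finsupp.single_eq_of_ne (fun h' => h h'.symm),
          Finsupp.single_eq_of_ne (fun h' => h (by omega)), mul_zero]

theorem lowest_weights_injective : Function.Injective fun j : ℕ => ν + 2 * (j : ℂ) := by
  intro i j h
  have h2 : (2 : ℂ) ≠ 0 := two_ne_zero
  exact_mod_cast mul_left_cancel₀ h2 (add_left_cancel h)

theorem isWeightModule_lowest (N : Submodule UAff (RelaxedVerma k Δ (lowestVermaRep ν))) :
    IsWeightModule (RelaxedVerma k Δ (lowestVermaRep ν) ⧸ N) k :=
  isWeightModule_quotient k Δ _ N (fun j => Finsupp.single j 1) (fun j => ν + 2 * j)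
    (lowestVermaRep_h_single ν) span_single (lowest_weights_injective ν)

variable {ν}

/-- Applying f lowers the top degree J + 1 and multiplies its coefficient by -(J + 1)(ν + J), which
is nonzero by `hν`. Repetition leaves a nonzero multiple of the lowest-weight vector. -/
theorem exists_smul_eq_lowest (hν : ∀ j : ℕ, ν + j ≠ 0) (J : ℕ) : ∀ m : ℕ →₀ ℂ, m ≠ 0 →
    (∀ j, J < j → m j = 0) → ∃ u : UAff, u • groundMap k Δ (lowestVermaRep ν) m =
      groundMap k Δ (lowestVermaRep ν) (Finsupp.single 0 1) := by
  induction J with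
  | zero =>
    intro m hm hJ
    have h1 : m = Finsupp.single 0 (m 0) := by
      ext j
      rcases j with _ | j
      · simp
      · rw [hJ _ (by omega), Finsupp.single_eq_of_ne (by omega)]
    have h2 : m 0 ≠ 0 := by
      intro h
      rw [h, Finsupp.single_zero] at h1
      exact hm h1
    refine ⟨algebraMap ℂ UAff (m 0)⁻¹, ?_⟩
    rw [algebraMap_smul, ← map_smul, h1]
    simp [h2]
  | succ J ih =>
    intro m hm hJ
    by_cases h0 : m (J + 1) = 0
    · refine ih m hm fun j hj => ?_
      rcases Nat.lt_or_ge (J + 1) j with h | h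
      · exact hJ j h
      · rwa [show j = J + 1 by omega]
    · obtain ⟨u, hu⟩ := ih (lowestVermaRep ν Sl2.f m) (fun h => by
        have h1 := lowestVermaRep_f_apply ν m J
        rw [h, Finsupp.zero_apply] at h1
        have h2 : (J : ℂ) + 1 ≠ 0 := by exact_mod_cast J.succ_ne_zero
        exact mul_ne_zero (neg_ne_zero.2 (mul_ne_zero h2 (hν J))) h0 h1.symm) (fun j hj => by
        rw [lowestVermaRep_f_apply, hJ _ (by omega), mul_zero])
      exact ⟨u * toU (mode Sl2.f 0), by rw [mul_smul, mode_zero_smul_groundMap, hu]⟩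

/-- If the lowest-weight Verma module is simple, then the sum of the proper submodules of the
induced module is its radical. -/
theorem sSup_proper_eq_radical (hν : ∀ j : ℕ, ν + j ≠ 0) :
    sSup {N : Submodule UAff (RelaxedVerma k Δ (lowestVermaRep ν)) | N ≠ ⊤} =
      radical k Δ (lowestVermaRep ν) := by
  refine le_antisymm (sSup_le fun N hN => le_radical _ _ _ ?_) (le_sSup fun h => ?_)
  · rw [eq_bot_iff]
    rintro _ ⟨hmem, ⟨m, rfl⟩⟩
    by_contra hne
    have hm : m ≠ 0 := by
      rintro rfl
      exact hne (by rw [map_zero]; exact Submodule.zero_mem _)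
    -- A nonzero ground state in `N` would yield the lowest-weight vector, then all ground states by
    -- applying e, and hence the whole module.
    refine hN (eq_top_iff.2 fun v _ => ?_)
    obtain ⟨u, hu⟩ := exists_smul_eq_lowest k Δ hν (m.support.sup id) m hm (fun j hj => by
      by_contra h
      have := Finset.le_sup (f := id) (Finsupp.mem_support_iff.2 h)
      simp only [id] at this
      omega)
    have h0 : ∀ j : ℕ, groundMap k Δ (lowestVermaRep ν) (Finsupp.single j 1) ∈ N := by
      intro j
      induction j with
      | zero => rw [← hu]; exact N.smul_mem _ hmem
      | succ j ih =>
        have := N.smul_mem (toU (mode Sl2.e 0)) ih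
        rwa [mode_zero_smul_groundMap, lowestVermaRep_e] at this
    refine relaxedVerma_induction k Δ _ (N.restrictScalars ℂ) (fun w m' => N.smul_mem _ ?_) v
    have hm' : m' ∈ Submodule.span ℂ (Set.range fun i : ℕ => Finsupp.single i (1 : ℂ)) := by
      rw [span_single]; trivial
    refine (Submodule.span_le (p := (N.restrictScalars ℂ).comap
      (groundMap k Δ (lowestVermaRep ν)))).2 ?_ hm'
    rintro _ ⟨j, rfl⟩
    exact h0 j
  -- Conversely the radical is proper, since the lowest-weight vector has a nonzero ground
  -- component.
  · have h1 : groundMap k Δ (lowestVermaRep ν) (Finsupp.single 0 1) ∈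
        radical k Δ (lowestVermaRep ν) := by rw [h]; trivial
    have h2 := h1 1
    rw [one_smul, groundProj_groundMap] at h2
    simp at h2

end Lowest

/-! ### Comparison of the dense module with its lowest-weight quotient -/

section Comparison

variable (k Δ : ℂ) {q : ℂ} {lam : ℂ ⧸ rootLattice} (μ : CosetWeights lam)

/-- The zero at j = 0 is what splits the dense module at μ; the other factor belongs to the second
solution -μ - 2. -/
theorem gam_shift (hμ : IsSolution q μ.1) (j : ℤ) :
    gam q (μ.1 + 2 * j) = -(j * (μ.1 + 1 + j)) := by
  rw [gam, ← hμ, weightForm, weightForm]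
  ring

/-- The number of steps from `μ` to another weight of its coset. -/
def stepsFrom (ν : CosetWeights lam) : ℤ := Classical.choose (μ.exists_shift_eq ν)

theorem stepsFrom_shift (j : ℤ) : stepsFrom μ (μ.shift j) = j :=
  μ.shift_injective (Classical.choose_spec (μ.exists_shift_eq (μ.shift j)))

/-- The scalars that relate the bases of the dense module and of the lowest-weight Verma module. -/
def rescale (μ : ℂ) : ℕ → ℂ
  | 0 => 1
  | i + 1 => rescale μ i * (-((i + 1) * (μ + 2 + i)))⁻¹

theorem rescale_ne_zero {μ : ℂ} (hν : ∀ j : ℕ, μ + 2 + j ≠ 0) (i : ℕ) : rescale μ i ≠ 0 := by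
  induction i with
  | zero => exact one_ne_zero
  | succ i ih =>
    have : (i : ℂ) + 1 ≠ 0 := by exact_mod_cast i.succ_ne_zero
    exact mul_ne_zero ih (inv_ne_zero (neg_ne_zero.2 (mul_ne_zero this (hν i))))

/-- This is compatibility with f, which has coefficient 1 on the dense basis but -(i + 1)(ν + i),
with ν = μ + 2, on the Verma basis. -/
theorem rescale_succ {μ : ℂ} (hν : ∀ j : ℕ, μ + 2 + j ≠ 0) (i : ℕ) :
    rescale μ (i + 1) * -((i + 1) * (μ + 2 + i)) = rescale μ i := by
  have h : (i : ℂ) + 1 ≠ 0 := by exact_mod_cast i.succ_ne_zero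
  rw [rescale, inv_mul_cancel_right₀ (neg_ne_zero.2 (mul_ne_zero h (hν i)))]

/-- The projection of the dense module onto its lowest-weight quotient. -/
def lowestQuotientMap : (CosetWeights lam →₀ ℂ) →ₗ[ℂ] (ℕ →₀ ℂ) :=
  Finsupp.lsum ℂ fun ν => if 1 ≤ stepsFrom μ ν then
    rescale μ.1 (stepsFrom μ ν - 1).toNat • Finsupp.lsingle (stepsFrom μ ν - 1).toNat else 0

theorem lowestQuotientMap_of_le {j : ℤ} (hj : j ≤ 0) (c : ℂ) :
    lowestQuotientMap μ (Finsupp.single (μ.shift j) c) = 0 := by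
  rw [lowestQuotientMap, Finsupp.lsum_single, stepsFrom_shift, if_neg (by omega)]
  rfl

theorem lowestQuotientMap_succ (i : ℕ) (c : ℂ) :
    lowestQuotientMap μ (Finsupp.single (μ.shift (i + 1)) c) =
      Finsupp.single i (rescale μ.1 i * c) := by
  rw [lowestQuotientMap, Finsupp.lsum_single, stepsFrom_shift, if_pos (by omega),
    show ((i : ℤ) + 1 - 1).toNat = i by omega, LinearMap.smul_apply, Finsupp.lsingle_apply,
    Finsupp.smul_single, smul_eq_mul]

theorem int_le_or_eq (j : ℤ) : j ≤ 0 ∨ ∃ i : ℕ, j = i + 1 := by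
  rcases le_or_gt j 0 with h | h
  · exact Or.inl h
  · exact Or.inr ⟨(j - 1).toNat, by omega⟩

theorem lowestQuotientMap_apply (v : CosetWeights lam →₀ ℂ) (i : ℕ) :
    lowestQuotientMap μ v i = rescale μ.1 i * v (μ.shift (i + 1)) := by
  induction v using Finsupp.induction_linear with
  | zero => simp
  | add v w hv hw => rw [map_add, Finsupp.add_apply, Finsupp.add_apply, hv, hw, mul_add]
  | single ν c =>
    obtain ⟨j, rfl⟩ := μ.exists_shift_eq ν
    rcases int_le_or_eq j with hj | ⟨i', rfl⟩
    · rw [lowestQuotientMap_of_le μ hj, Finsupp.single_eq_of_ne, mul_zero, Finsupp.zero_apply]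
      intro h
      have := μ.shift_injective h
      omega
    · rw [lowestQuotientMap_succ]
      by_cases h : i' = i
      · subst h
        rw [Finsupp.single_eq_same, Finsupp.single_eq_same]
      · rw [Finsupp.single_eq_of_ne (fun h' => h h'.symm), Finsupp.single_eq_of_ne, mul_zero]
        intro h'
        have := μ.shift_injective h'
        omega

theorem lowestQuotientMap_rep (hμ : IsSolution q μ.1) (hν : ∀ j : ℕ, μ.1 + 2 + j ≠ 0)
    (x : Sl2) (v : CosetWeights lam →₀ ℂ) :
    lowestQuotientMap μ (denseRep q lam x v) =
      lowestVermaRep (μ.1 + 2) x (lowestQuotientMap μ v) := by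
  refine map_rep_of_gens _ _ _ ?_ ?_ ?_ x v
  · refine Finsupp.lhom_ext fun ν c => ?_
    obtain ⟨j, rfl⟩ := μ.exists_shift_eq ν
    rw [LinearMap.comp_apply, LinearMap.comp_apply, denseRep_e, CosetWeights.shift_up,
      CosetWeights.shift_coe, gam_shift μ hμ]
    rcases int_le_or_eq j with hj | ⟨i, rfl⟩
    · rw [lowestQuotientMap_of_le μ hj, map_zero]
      -- Only e v_μ could leave the span of the v_{μ+jα} with j ≤ 0, and its coefficient γ_μ is
      -- zero.
      rcases hj.lt_or_eq with hj | rfl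
      · rw [lowestQuotientMap_of_le μ (by omega)]
      · simp
    · have e : ((i : ℤ) + 1 + 1) = ((i + 1 : ℕ) : ℤ) + 1 := by push_cast; ring
      rw [e, lowestQuotientMap_succ, lowestQuotientMap_succ, lowestVermaRep_e,
        ← rescale_succ hν i]
      congr 1
      push_cast
      ring
  · refine Finsupp.lhom_ext fun ν c => ?_
    obtain ⟨j, rfl⟩ := μ.exists_shift_eq ν
    rw [LinearMap.comp_apply, LinearMap.comp_apply, denseRep_h, CosetWeights.shift_coe]
    rcases int_le_or_eq j with hj | ⟨i, rfl⟩
    · rw [lowestQuotientMap_of_le μ hj, lowestQuotientMap_of_le μ hj, map_zero]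
    · rw [lowestQuotientMap_succ, lowestQuotientMap_succ, lowestVermaRep_h]
      congr 1
      push_cast
      ring
  · refine Finsupp.lhom_ext fun ν c => ?_
    obtain ⟨j, rfl⟩ := μ.exists_shift_eq ν
    rw [LinearMap.comp_apply, LinearMap.comp_apply, denseRep_f, CosetWeights.shift_down]
    rcases int_le_or_eq j with hj | ⟨i, rfl⟩
    · rw [lowestQuotientMap_of_le μ hj, lowestQuotientMap_of_le μ (by omega), map_zero]
    · rw [lowestQuotientMap_succ, lowestVermaRep_f]
      rcases i with _ | i
      · rw [lowestQuotientMap_of_le μ (by simp)]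
        simp
      · rw [Nat.add_sub_cancel, show (((i + 1 : ℕ) : ℤ) + 1 - 1) = (i : ℤ) + 1 by push_cast; ring,
          lowestQuotientMap_succ, ← rescale_succ hν i]
        congr 1
        push_cast
        ring

/-- Far up, the weight spaces of the lowest-weight module have the dimension given by the generic
rank of the pairing. -/
theorem finrank_weightSpace_lowest (hμ : IsSolution q μ.1) (hν : ∀ j : ℕ, μ.1 + 2 + j ≠ 0)
    (N : Submodule UAff (RelaxedVerma k Δ (lowestVermaRep (μ.1 + 2))))
    (hN : N = radical k Δ (lowestVermaRep (μ.1 + 2)))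
    (n d : ℕ) (κ : Finset (UAff × ℤ)) (S : Finset ℂ)
    (hS : ∀ x ∉ S, Module.finrank ℂ (polyKer (pairing q k Δ n) x) = d ∧
      ∀ c : WordOf n → ℂ, (∀ i ∈ κ, ∑ w, (pairing q k Δ n i w).eval x * c w = 0) →
        c ∈ polyKer (pairing q k Δ n) x)
    (m : ℤ) (hm : ∀ w : WordOf n, wordWt w.1 ≤ m) (hκ : ∀ i ∈ κ, 0 ≤ m + i.2)
    (hmS : μ.1 + 2 * (m + 1 : ℤ) ∉ S) :
    Module.finrank ℂ (weightSpace (RelaxedVerma k Δ (lowestVermaRep (μ.1 + 2)) ⧸ N)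
      (μ.1 + 2 + m * 2) (Δ + n)) + d = Fintype.card (WordOf n) := by
  obtain ⟨hd, hker⟩ := hS _ hmS
  -- The word w must be applied to the basis vector m - wt(w) steps above the lowest weight; `hm`
  -- ensures that this number is not truncated.
  let g : WordOf n → ℕ := fun w => (m - wordWt w.1).toNat
  have hg : ∀ w : WordOf n, ((g w : ℕ) : ℤ) = m - wordWt w.1 :=
    fun w => Int.toNat_of_nonneg (by have := hm w; omega)
  have hgc : ∀ w : WordOf n, (g w : ℂ) = m - wordWt w.1 := fun w => by exact_mod_cast hg w
  let F := relaxedMap k Δ (denseRep q lam) (lowestVermaRep (μ.1 + 2)) (lowestQuotientMap μ)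
    (lowestQuotientMap_rep μ hμ hν)
  rw [← hd]
  refine finrank_weightSpace_quotient k Δ _ N (fun j : ℕ => Finsupp.single j 1)
    (fun j : ℕ => μ.1 + 2 + 2 * (j : ℂ)) (lowestVermaRep_h_single (μ.1 + 2)) span_single
    (lowest_weights_injective (μ.1 + 2)) _ n g (fun w => rescale μ.1 (g w))
    (fun w => rescale_ne_zero hν _) (fun w => ?_) _ (fun c => ?_)
  · rw [hgc]; ring
  · have e : ∑ w, c w • rescale μ.1 (g w) • wordVec k Δ (lowestVermaRep (μ.1 + 2)) N
        (fun j : ℕ => Finsupp.single j 1) (w.1, g w) =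
        N.mkQ (F (wordComb q k Δ n (μ.shift (m + 1)) c)) := by
      rw [wordComb, Fintype.linearCombination_apply, map_sum, map_sum]
      refine Finset.sum_congr rfl fun w _ => ?_
      have e1 : (μ.shift (m + 1)).shift (-wordWt w.1) = μ.shift (g w + 1) := by
        refine Subtype.ext ?_
        rw [CosetWeights.shift_coe, CosetWeights.shift_coe, CosetWeights.shift_coe, hg]
        push_cast
        ring
      rw [relaxedMap_smul, relaxedMap_smul_groundMap, e1, lowestQuotientMap_succ, mul_one]
      have e2 : Finsupp.single (g w) (rescale μ.1 (g w)) =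
          rescale μ.1 (g w) • Finsupp.single (g w) (1 : ℂ) := by
        rw [Finsupp.smul_single, smul_eq_mul, mul_one]
      rw [e2, (groundMap k Δ _).map_smul, smul_comm (wordElt w.1)]
      rfl
    rw [e, Submodule.mkQ_apply, Submodule.Quotient.mk_eq_zero, hN]
    -- The i-th ground weight is μ + (i + 1)α, which is i - m steps from the total weight μ + (m +
    -- 1)α. Hence precisely the rows (u, j) with j ≥ -m remain visible in the quotient, and by `hκ`
    -- they include the decisive rows κ.
    have hF : ∀ (u : UAff) (i : ℕ), groundProj k Δ (lowestVermaRep (μ.1 + 2))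
        (u • F (wordComb q k Δ n (μ.shift (m + 1)) c)) i =
        rescale μ.1 i * ∑ w, (pairing q k Δ n (u, i - m) w).eval (μ.shift (m + 1)).1 * c w := by
      intro u i
      rw [← groundProj_wordComb, ← map_smul, groundProj_relaxedMap, lowestQuotientMap_apply]
      congr 2
      refine Subtype.ext ?_
      rw [CosetWeights.shift_coe, CosetWeights.shift_coe, CosetWeights.shift_coe]
      push_cast
      ring
    constructor
    · intro h
      refine hker c ?_
      rintro ⟨u, j⟩ hj
      have h1 : 0 ≤ m + j := hκ _ hj
      have h2 := hF u (m + j).toNat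
      rw [h u, Finsupp.zero_apply, Int.toNat_of_nonneg h1, add_sub_cancel_left] at h2
      exact (mul_eq_zero.1 h2.symm).resolve_left (rescale_ne_zero hν _)
    · intro h u
      ext i
      rw [hF]
      exact mul_eq_zero_of_right _ (h (u, i - m))

/-- If μ = -2 - j, then 1 + 2q = (j + 1)² is an integral square and the second solution is j, whose
real part is larger. This contradicts maximality. -/
theorem ne_zero_of_isPreferredSolution {q μ : ℂ} (hμ : IsPreferredSolution q μ) (j : ℕ) :
    μ + 2 + j ≠ 0 := by
  intro h
  obtain rfl : μ = -2 - j := by linear_combination h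
  have h1 : q = (j + 2) * j / 2 := by
    rw [← hμ.1, weightForm]
    ring
  have h2 := hμ.2 ⟨j + 1, by rw [h1]; push_cast; ring⟩ j (by
    rw [IsSolution, h1, weightForm]
    ring)
  simp only [Complex.natCast_re, Complex.sub_re, Complex.neg_re, Complex.re_ofNat] at h2
  have h3 : (0 : ℝ) ≤ j := j.cast_nonneg
  linarith

end Comparison

/-! ### String functions and their limit -/

section StringFunctions

variable (k Δ q : ℂ) (lam : ℂ ⧸ rootLattice)

theorem nonGroundSum_dense : nonGroundSum k Δ (denseRep q lam) = radical k Δ (denseRep q lam) :=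
  nonGroundSum_eq_radical k Δ _

theorem coset_add_zsmul (μ : ℂ) (j : ℤ) :
    ((μ + j * 2 : ℂ) : ℂ ⧸ rootLattice) = (μ : ℂ ⧸ rootLattice) := by
  refine QuotientAddGroup.eq.mpr ?_
  rw [AddSubgroup.mem_zmultiples_iff]
  exact ⟨-j, by simp⟩

theorem weightSpace_dense_eq_bot_of_notMem (N : Submodule UAff (RelaxedVerma k Δ (denseRep q lam)))
    {ν : ℂ} (hν : (ν : ℂ ⧸ rootLattice) ≠ lam) (n : ℂ) :
    weightSpace (RelaxedVerma k Δ (denseRep q lam) ⧸ N) ν n = ⊥ := by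
  refine weightSpace_quotient_eq_bot k Δ _ N (fun μ => Finsupp.single μ 1) Subtype.val
    (denseRep_h_single q) span_single ν n fun w μ h _ => hν ?_
  rw [← h, coset_add_zsmul, μ.2]

theorem weightSpace_dense_eq_bot_of_energy
    (N : Submodule UAff (RelaxedVerma k Δ (denseRep q lam))) (ν : ℂ) {n : ℂ}
    (hn : ∀ d : ℕ, Δ + d ≠ n) :
    weightSpace (RelaxedVerma k Δ (denseRep q lam) ⧸ N) ν n = ⊥ :=
  weightSpace_quotient_eq_bot k Δ _ N (fun μ => Finsupp.single μ 1) Subtype.val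
    (denseRep_h_single q) span_single ν n fun _ _ _ h => hn _ h

theorem weightSpace_lowest_eq_bot_of_energy (μ : ℂ)
    (N : Submodule UAff (RelaxedVerma k Δ (lowestVermaRep μ))) (ν : ℂ) {n : ℂ}
    (hn : ∀ d : ℕ, Δ + d ≠ n) :
    weightSpace (RelaxedVerma k Δ (lowestVermaRep μ) ⧸ N) ν n = ⊥ :=
  weightSpace_quotient_eq_bot k Δ _ N (fun j => Finsupp.single j 1) (fun j => μ + 2 * j)
    (lowestVermaRep_h_single μ) span_single ν n fun _ _ _ h => hn _ h

/-- In each conformal weight Δ + n both dimensions equal the number of words of degree n minus the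
generic kernel dimension. -/
theorem stringFunction_relaxed_eq {ν ν' : ℂ} (hν : (ν : ℂ ⧸ rootLattice) = lam)
    (hν' : (ν' : ℂ ⧸ rootLattice) = lam) :
    stringFunction (RelaxedModule k Δ q lam) ν = stringFunction (RelaxedModule k Δ q lam) ν' := by
  ext n
  rw [stringFunction, stringFunction]
  by_cases hn : ∃ d : ℕ, Δ + d = n
  · obtain ⟨n, rfl⟩ := hn
    obtain ⟨κ, d, S, hS⟩ := exists_generic_polyKer (pairing q k Δ n)
    have h := finrank_weightSpace_dense_eq k Δ q _ (nonGroundSum_dense k Δ q lam) n d S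
      fun μ hμ => (hS μ hμ).1
    have h1 := h ⟨ν, hν⟩
    have h2 := h ⟨ν', hν'⟩
    exact add_right_cancel (h1.trans h2.symm)
  · have hn : ∀ d : ℕ, Δ + d ≠ n := fun d hd => hn ⟨d, hd⟩
    rw [weightSpace_dense_eq_bot_of_energy k Δ q lam _ ν hn,
      weightSpace_dense_eq_bot_of_energy k Δ q lam _ ν' hn]

theorem stringFunction_relaxed_ne_zero (ν : ℂ) :
    stringFunction (RelaxedModule k Δ q lam) ν ≠ 0 ↔ (ν : ℂ ⧸ rootLattice) = lam := by
  constructor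
  · intro h
    by_contra hν
    refine h (funext fun n => ?_)
    rw [stringFunction, weightSpace_dense_eq_bot_of_notMem k Δ q lam _ hν, finrank_bot]
    rfl
  · intro hν h
    have h1 : Module.finrank ℂ (weightSpace (RelaxedModule k Δ q lam) ν Δ) = 0 := congr_fun h Δ
    have := (isWeightModule_dense k Δ q (nonGroundSum k Δ (denseRep q lam))).finite_weightSpace ν Δ
    have h2 : weightSpace (RelaxedModule k Δ q lam) ν Δ = ⊥ := Submodule.finrank_eq_zero.1 h1
    -- The empty word applied to v_ν lies in the weight space (ν, Δ) and is nonzero, because its own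
    -- ground component is v_ν.
    have h3 := mem_weightSpace_of_smul _
      (wordVec k Δ _ (nonGroundSum k Δ (denseRep q lam)) fun μ => Finsupp.single μ 1) _ _
      (h_smul_wordVec k Δ _ _ _ Subtype.val (denseRep_h_single q)) (L0_smul_wordVec k Δ _ _ _)
      (([], ⟨ν, hν⟩) : Word × CosetWeights lam)
    have e1 : (ν : ℂ) + wordWt [] * 2 = ν := by simp [wordWt]
    have e2 : Δ + wordDeg [] = Δ := by simp [wordDeg]
    simp only [e1, e2] at h3
    rw [h2, Submodule.mem_bot, wordVec, Submodule.Quotient.mk_eq_zero, nonGroundSum_dense,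
      wordElt_nil] at h3
    have h4 := h3 1
    rw [one_smul, one_smul, groundProj_groundMap] at h4
    simp at h4

theorem isStringy_relaxed : IsStringy (RelaxedModule k Δ q lam) k where
  isWeightModule := isWeightModule_dense k Δ q _
  eq_of_ne_zero μ ν hμ hν := stringFunction_relaxed_eq k Δ q lam
    ((stringFunction_relaxed_ne_zero k Δ q lam μ).1 hμ)
    ((stringFunction_relaxed_ne_zero k Δ q lam ν).1 hν)

/-- Each coefficient is eventually constant. The same generic data d, κ and S serve the coset of ν
and the coset of μ, which may differ. -/
theorem hasPosLimit_lowest {μ : ℂ} (hμ : IsPreferredSolution q μ) {ν : ℂ}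
    (hν : (ν : ℂ ⧸ rootLattice) = lam) :
    HasPosLimit (SimpleLowest k Δ (μ + simpleRoot)) (μ + simpleRoot)
      (stringFunction (RelaxedModule k Δ q lam) ν) := by
  intro n
  refine tendsto_const_nhds.congr' ?_
  by_cases hn : ∃ d : ℕ, Δ + d = n
  · obtain ⟨n, rfl⟩ := hn
    obtain ⟨κ, d, S, hS⟩ := exists_generic_polyKer (pairing q k Δ n)
    have h1 := finrank_weightSpace_dense_eq k Δ q _ (nonGroundSum_dense k Δ q lam) n d S
      (fun μ hμ => (hS μ hμ).1) ⟨ν, hν⟩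
    obtain ⟨B, hB⟩ := (finite_shift_mem μ S).bddAbove
    -- Three conditions hold for large m: every word has a ground state to act on, all rows in κ are
    -- visible, and the weight is not exceptional. The last holds for m ≥ B because the relevant
    -- step is m + 1.
    have hw : ∀ᶠ m : ℤ in Filter.atTop, ∀ w : WordOf n, wordWt w.1 ≤ m :=
      Filter.eventually_all.2 fun w => Filter.eventually_ge_atTop _
    have hκ : ∀ᶠ m : ℤ in Filter.atTop, ∀ i ∈ κ, 0 ≤ m + i.2 :=
      (Filter.eventually_all_finset κ).2 fun i _ =>
        (Filter.eventually_ge_atTop (-i.2)).mono fun m hm => by omega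
    filter_upwards [hw, hκ, Filter.eventually_ge_atTop B] with m hm hmκ hmB
    have hν' := ne_zero_of_isPreferredSolution hμ
    have h2 := finrank_weightSpace_lowest k Δ (⟨μ, rfl⟩ : CosetWeights (μ : ℂ ⧸ rootLattice)) hμ.1
      hν' _ (sSup_proper_eq_radical k Δ hν') n d κ S hS m hm hmκ (fun h => by
        have := hB h
        omega)
    exact add_right_cancel (h1.trans h2.symm)
  · have hn : ∀ d : ℕ, Δ + d ≠ n := fun d hd => hn ⟨d, hd⟩
    refine Filter.Eventually.of_forall fun m => ?_
    change Module.finrank ℂ (weightSpace _ _ _) = Module.finrank ℂ (weightSpace _ _ _)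
    rw [weightSpace_dense_eq_bot_of_energy k Δ q lam _ ν hn,
      weightSpace_lowest_eq_bot_of_energy k Δ _ _ _ hn, finrank_bot, finrank_bot]

end StringFunctions

end RelaxedSl2

end

theorem mainTheorem2 (k Δ q : ℂ) (lam : ℂ ⧸ RelaxedSl2.rootLattice)
    (hlam : lam ∈ RelaxedSl2.nonsimpleCosets q) :
    RelaxedSl2.IsStringy (RelaxedSl2.RelaxedModule k Δ q lam) k ∧
    (∀ ν : ℂ, RelaxedSl2.stringFunction (RelaxedSl2.RelaxedModule k Δ q lam) ν ≠ 0 ↔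
      (ν : ℂ ⧸ RelaxedSl2.rootLattice) = lam) ∧
    ∀ μ : ℂ, RelaxedSl2.IsPreferredSolution q μ →
      RelaxedSl2.IsWeightModule (RelaxedSl2.SimpleLowest k Δ (μ + RelaxedSl2.simpleRoot)) k ∧
      ∀ ν : ℂ, (ν : ℂ ⧸ RelaxedSl2.rootLattice) = lam →
        RelaxedSl2.HasPosLimit (RelaxedSl2.SimpleLowest k Δ (μ + RelaxedSl2.simpleRoot)) (μ + RelaxedSl2.simpleRoot)
          (RelaxedSl2.stringFunction (RelaxedSl2.RelaxedModule k Δ q lam) ν) :=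
  ⟨RelaxedSl2.isStringy_relaxed k Δ q lam, RelaxedSl2.stringFunction_relaxed_ne_zero k Δ q lam,
    fun _ hμ => ⟨RelaxedSl2.isWeightModule_lowest k Δ _ _,
      fun _ hν => RelaxedSl2.hasPosLimit_lowest k Δ q lam hμ hν⟩⟩
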